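/- Let $N\ge 3$ and let $q>0$ be real. For $1\le i\le N$ put $i'=N+1-i$, and let $(\rho_1,\dots,\rho_N)=(n-\tfrac12,\dots,\tfrac12,0,-\tfrac12,\dots,\tfrac12-n)$ if $N=2n+1$ and $(n-1,\dots,1,0,0,-1,\dots,1-n)$ if $N=2n$. Let $\hat R^{ij}_{kl}=R^{ji}_{kl}$, where $R^{ij}_{kl}$ is the coefficient of $e_{ik}\otimes e_{jl}$ in the Faddeev–Reshetikhin–Takhtajan $R$-matrix of $SO_q(N)$, $$R=q\sum_{i\ne i'}e_{ii}\otimes e_{ii}+\sum_{i=i'}e_{ii}\otimes e_{ii}+\sum_{i\ne j,j'}e_{ii}\otimes e_{jj}+q^{-1}\sum_{i\neq i'}e_{ii}\otimes e_{i'i'}+(q-q^{-1})\sum_{i>j}e_{ij}\otimes e_{ji}-(q-q^{-1})\sum_{i>j}q^{\rho_i-\rho_j}e_{ij}\otimes e_{i'j'}.$$ Let $g_{ij}=q^{-\rho_i}\delta_{ij'}$ be the quantum Euclidean metric, $g^{ij}$ its inverse ($g_{ik}g^{kj}=\delta_i^j$), and $D^i_l=\sum_k g^{ik}g_{lk}$.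 Let $\Lambda_q$ be the unital complex algebra generated by $dx^1,\dots,dx^N$ with the relations $$dx^i dx^j=-q\sum_{k,l}\hat R^{ij}_{kl}\,dx^k dx^l .$$ Then there is a unique family of complex numbers $\varepsilon_q^{i_1\dots i_N}$ (the $q$-epsilon tensor of $SO_q(N)$) with $$dx^{i_1}\cdots dx^{i_N}=\varepsilon_q^{i_1\dots i_N}\,dx^1\cdots dx^N\qquad\text{for all } i_1,\dots,i_N ,$$ and it has the cyclic property $$\varepsilon_q^{i_1\dots i_N}=(-1)^{N-1}\sum_{j} D^{i_1}_{j}\,\varepsilon_q^{i_2\dots i_N j}\qquad\text{for all } i_1,\dots,i_N .$$ -/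

import Mathlib

noncomputable section

namespace QEuclid

/-- The half sum of positive roots `ρ` of `so(N)`, extended to all indices. With indices running
through `0, …, N - 1` and `i' = N - 1 - i` it is `ρ = (N/2 - 1, N/2 - 2, …, 1 - N/2)`, where the
value `0` is taken once in the middle for odd `N` and twice in the middle for even `N`;
`ρ (i') = -ρ i`. -/
def rho {N : ℕ} (i : Fin N) : ℝ :=
  if 2 * (i : ℕ) + 1 < N then (N : ℝ) / 2 - 1 - (i : ℝ)
  else if 2 * (i : ℕ) + 1 = N then 0
  else (N : ℝ) / 2 - (i : ℝ)

/-- The Faddeev-Reshetikhin-Takhtajan matrix `R` of the orthogonal series, with entries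
`R^{ij}_{kl}` (the coefficient of `e_{ik} ⊗ e_{jl}`):
`R = q ∑_{a ≠ a'} e_{aa} ⊗ e_{aa} + ∑_{a = a'} e_{aa} ⊗ e_{aa} + ∑_{a ≠ b, b'} e_{aa} ⊗ e_{bb}
 + q⁻¹ ∑_{a ≠ a'} e_{aa} ⊗ e_{a'a'} + (q - q⁻¹) ∑_{a > b} e_{ab} ⊗ e_{ba}
 - (q - q⁻¹) ∑_{a > b} q^{ρ_a - ρ_b} e_{ab} ⊗ e_{a'b'}`. -/
def R {N : ℕ} (q : ℝ) (i j k l : Fin N) : ℝ :=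
  (if k = i ∧ l = j then
      (if i = j then (if i = i.rev then 1 else q) else (if i = j.rev then q⁻¹ else 1))
    else 0)
  + (if k = j ∧ l = i ∧ j < i then q - q⁻¹ else 0)
  - (if j = i.rev ∧ l = k.rev ∧ k < i then (q - q⁻¹) * q ^ (rho i - rho k) else 0)

/-- The braid matrix `R̂^{ij}_{kl} = R^{ji}_{kl}`. -/
def Rhat {N : ℕ} (q : ℝ) (i j k l : Fin N) : ℝ := R q j i k l

/-- The quantum Euclidean metric `g_{ij}` (lower indices), `g_{ij} = q^{-ρ_i} δ_{i j'}`. -/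
def gLow (N : ℕ) (q : ℝ) : Matrix (Fin N) (Fin N) ℝ :=
  Matrix.of fun i j => if j = i.rev then q ^ (-rho i) else 0

/-- The metric `g^{ij}` with upper indices, `g_{ik} g^{kj} = δ_i^j`. -/
def gUp (N : ℕ) (q : ℝ) : Matrix (Fin N) (Fin N) ℝ := (gLow N q)⁻¹

/-- The matrix `D^i_l = g^{ik} g_{lk}`. -/
def D (N : ℕ) (q : ℝ) : Matrix (Fin N) (Fin N) ℝ :=
  Matrix.of fun i l => ∑ k, gUp N q i k * gLow N q l k

/-- The commutation relations of the differentials: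
`dx^i dx^j = - q R̂^{ij}_{kl} dx^k dx^l`. -/
inductive FormRel (N : ℕ) (q : ℝ) : FreeAlgebra ℂ (Fin N) → FreeAlgebra ℂ (Fin N) → Prop
  | comm (i j : Fin N) : FormRel N q
      (FreeAlgebra.ι ℂ i * FreeAlgebra.ι ℂ j)
      (∑ k, ∑ l, ((-(q * Rhat q i j k l) : ℝ) : ℂ) •
        (FreeAlgebra.ι ℂ k * FreeAlgebra.ι ℂ l))

/-- The algebra of constant-coefficient forms on quantum Euclidean space: the unital complex
algebra generated by `dx^1, …, dx^N` modulo the commutation relations. -/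
abbrev Forms (N : ℕ) (q : ℝ) : Type := RingQuot (FormRel N q)

/-- The generator `dx^i`. -/
def dx {N : ℕ} (q : ℝ) (i : Fin N) : Forms N q :=
  RingQuot.mkAlgHom ℂ (FormRel N q) (FreeAlgebra.ι ℂ i)

/-- The `N`-form `dx^{i_1} dx^{i_2} ⋯ dx^{i_N}` (product in this order). -/
def dxWord {N : ℕ} (q : ℝ) (i : Fin N → Fin N) : Forms N q :=
  (List.ofFn fun k => dx q (i k)).prod

/-- `ε` is a `q`-epsilon tensor: `dx^{i_1} ⋯ dx^{i_N} = ε^{i_1 … i_N} dx^1 ⋯ dx^N`. -/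
def IsEpsilonTensor (N : ℕ) (q : ℝ) (ε : (Fin N → Fin N) → ℂ) : Prop :=
  ∀ i : Fin N → Fin N, dxWord q i = ε i • dxWord q id

/-- The multi-index `(i_2, …, i_N, j)` obtained from `(i_1, i_2, …, i_N)`. -/
def cycleIndex {N : ℕ} (i : Fin N → Fin N) (j : Fin N) : Fin N → Fin N :=
  fun k => if h : (k : ℕ) + 1 < N then i ⟨(k : ℕ) + 1, h⟩ else j

end QEuclid

end

/-! The relations can be solved for ordered products. A generator with `i ≠ i'` squares to zero,
generators that are neither equal nor conjugate `q`-commute, and the anticommutator of `x_i` and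
`x_{i'}`, like the square of the middle generator, is a multiple of a partial metric sum over the
pairs outside `i`. Solving divides only by `1 + q` and `1 + q²`, which are nonzero for `q > 0`.

Upper bound and cyclicity. In the order `1, 1', 2, 2', …` every correction term is quadratic in
earlier pairs. If `V_k` is the span of the first `k` generators, then `V_k ^ (k + 1) = 0` and `V_k ^
k` is spanned by one ordered product (`IsTower.initSpan_pow`), so degree `N` is at most a line. The
same vanishing kills the corrections when a generator is carried around a form of degree `N - 1`,
leaving a scalar (`IsTower.mul_eq_cyclicFactor_smul`). By `cyclicFactor_eq` this scalar is `(-1) ^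
(N - 1) * q ^ (-2ρ_i)`, the signed diagonal entry of `D`.

Nonvanishing. The volume form is nonzero because it is nonzero in a concrete algebra. Conjugate
pairs are adjoined one at a time by tensoring with the operators on an exterior algebra in two
generators (`IsTwistedPairSystem.exists_extend`); a derivation `∂/∂α` produces the metric sum in the
anticommutator. For odd `N` the middle generator is a combination of the two members of an extra
pair. `IsExterior.relations` shows that the solved relations suffice to map the algebra of forms
there. -/

noncomputable section
namespace QEuclid

/-! ### Top degree of an algebra with triangular quadratic relations. -/

section Tower

variable {A : Type*} [Ring A] [Algebra ℂ A]

/-- The span of the first `k` members of a sequence. -/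
def initSpan (y : ℕ → A) (k : ℕ) : Submodule ℂ A := Submodule.span ℂ (y '' Set.Iio k)

/-- The ordered product of the first `k` members of a sequence. -/
def initProd (y : ℕ → A) : ℕ → A
  | 0 => 1
  | k + 1 => initProd y k * y k

/-- The factor picked up when a generator is moved past the earlier generator number `i`. -/
def exchange (q : ℂ) (i : ℕ) : ℂ := if Even i then -q else -q⁻¹

/-- Generators arranged in hyperbolic pairs `y (2 m), y (2 m + 1)` which `q`-commute with all
earlier generators and, within a pair, anticommute up to quadratic terms in earlier pairs. -/
structure IsTower (q : ℂ) (N : ℕ) (y : ℕ → A) : Prop where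
  exch : ∀ i j, i < j → j < N → ¬ (Even i ∧ j = i + 1) →
    y j * y i = exchange q i • (y i * y j)
  pair : ∀ i, Even i → i + 1 < N → y (i + 1) * y i + y i * y (i + 1) ∈ initSpan y i ^ 2
  sq_even : ∀ i, i < N → Even i → y i * y i ∈ initSpan y i ^ 2
  sq_odd : ∀ i, i < N → ¬ Even i → y i * y i = 0

lemma initSpan_zero (y : ℕ → A) : initSpan y 0 = ⊥ := by simp [initSpan]

lemma initSpan_succ (y : ℕ → A) (k : ℕ) :
    initSpan y (k + 1) = initSpan y k ⊔ Submodule.span ℂ {y k} := by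
  have : Set.Iio (k + 1) = insert k (Set.Iio k) := by ext; simp
  rw [initSpan, this, Set.image_insert_eq, Submodule.span_insert, sup_comm, initSpan]

lemma mem_initSpan (y : ℕ → A) {i k : ℕ} (h : i < k) : y i ∈ initSpan y k :=
  Submodule.subset_span ⟨i, h, rfl⟩

lemma initSpan_mono (y : ℕ → A) {i k : ℕ} (h : i ≤ k) : initSpan y i ≤ initSpan y k :=
  Submodule.span_mono (Set.image_mono (Set.Iio_subset_Iio h))

lemma mul_pow_le_of_mul_le {V Z : Submodule ℂ A} (hZV : Z * V ≤ V * Z) (d : ℕ) :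
    Z * V ^ d ≤ V ^ d * Z := by
  induction d with
  | zero => simp
  | succ d ih =>
    calc Z * V ^ (d + 1) = Z * V ^ d * V := by rw [pow_succ, mul_assoc]
      _ ≤ V ^ d * Z * V := mul_le_mul_left ih V
      _ = V ^ d * (Z * V) := mul_assoc _ _ _
      _ ≤ V ^ d * (V * Z) := mul_le_mul_right hZV _
      _ = V ^ (d + 1) * Z := by rw [pow_succ, mul_assoc]

lemma mul_pow_le_of_mul_le_sup {V Z : Submodule ℂ A} (hZV : Z * V ≤ V * Z ⊔ V ^ 2) (d : ℕ) :
    Z * V ^ d ≤ V ^ d * Z ⊔ V ^ (d + 1) := by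
  induction d with
  | zero => simp
  | succ d ih =>
    calc Z * V ^ (d + 1) = Z * V ^ d * V := by rw [pow_succ, mul_assoc]
      _ ≤ (V ^ d * Z ⊔ V ^ (d + 1)) * V := mul_le_mul_left ih V
      _ = V ^ d * (Z * V) ⊔ V ^ (d + 2) := by rw [Submodule.sup_mul, mul_assoc, ← pow_succ]
      _ ≤ V ^ d * (V * Z ⊔ V ^ 2) ⊔ V ^ (d + 2) := sup_le_sup_right (mul_le_mul_right hZV _) _
      _ = V ^ (d + 1) * Z ⊔ V ^ (d + 1 + 1) := by
        rw [Submodule.mul_sup, ← mul_assoc, ← pow_succ, ← pow_add, sup_assoc, sup_idem]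

/-- Factors from `Z` can be pushed to the right at the cost of terms in `V ^ 2`, and two of them
meeting are absorbed into `V ^ 2`; so at most one survives, in last place. -/
lemma sup_pow_le {V Z : Submodule ℂ A} (hZV : Z * V ≤ V * Z ⊔ V ^ 2) (hZ : Z * Z ≤ V ^ 2)
    (d : ℕ) : (V ⊔ Z) ^ (d + 1) ≤ V ^ (d + 1) ⊔ V ^ d * Z := by
  induction d with
  | zero => simp
  | succ d ih =>
    have h1 : Z * V ^ (d + 1) ≤ V ^ (d + 1 + 1) ⊔ V ^ (d + 1) * Z := by
      rw [sup_comm]; exact mul_pow_le_of_mul_le_sup hZV (d + 1)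
    have h2 : Z * (V ^ d * Z) ≤ V ^ (d + 1 + 1) ⊔ V ^ (d + 1) * Z := by
      calc Z * (V ^ d * Z) = Z * V ^ d * Z := (mul_assoc _ _ _).symm
        _ ≤ (V ^ d * Z ⊔ V ^ (d + 1)) * Z := mul_le_mul_left (mul_pow_le_of_mul_le_sup hZV d) Z
        _ = V ^ d * (Z * Z) ⊔ V ^ (d + 1) * Z := by rw [Submodule.sup_mul, mul_assoc]
        _ ≤ V ^ d * V ^ 2 ⊔ V ^ (d + 1) * Z := sup_le_sup_right (mul_le_mul_right hZ _) _
        _ = _ := by rw [← pow_add]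
    calc (V ⊔ Z) ^ (d + 1 + 1) = (V ⊔ Z) * (V ⊔ Z) ^ (d + 1) := pow_succ' _ _
      _ ≤ (V ⊔ Z) * (V ^ (d + 1) ⊔ V ^ d * Z) := mul_le_mul_right ih _
      _ = (V * V ^ (d + 1) ⊔ V * (V ^ d * Z)) ⊔ (Z * V ^ (d + 1) ⊔ Z * (V ^ d * Z)) := by
        rw [Submodule.sup_mul, Submodule.mul_sup, Submodule.mul_sup]
      _ ≤ V ^ (d + 1 + 1) ⊔ V ^ (d + 1) * Z := by
        rw [← pow_succ', ← mul_assoc, ← pow_succ']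
        exact sup_le le_rfl (sup_le h1 h2)

namespace IsTower

variable {q : ℂ} {N : ℕ} {y : ℕ → A} (h : IsTower q N y)
include h

lemma span_mul_initSpan_le {k : ℕ} (hk : k < N) :
    Submodule.span ℂ {y k} * initSpan y k ≤
      initSpan y k * Submodule.span ℂ {y k} ⊔ initSpan y k ^ 2 := by
  rw [initSpan, Submodule.span_mul_span, Submodule.span_le]
  rintro _ ⟨_, rfl, _, ⟨i, hi, rfl⟩, rfl⟩
  have hi : i < k := hi
  have hmem : y i * y k ∈ initSpan y k * Submodule.span ℂ {y k} :=
    Submodule.mul_mem_mul (mem_initSpan y hi) (Submodule.mem_span_singleton_self _)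
  by_cases hp : Even i ∧ k = i + 1
  · obtain ⟨he, rfl⟩ := hp
    have h1 := h.pair i he hk
    have h2 : y (i + 1) * y i = -(y i * y (i + 1)) + (y (i + 1) * y i + y i * y (i + 1)) := by
      abel
    rw [SetLike.mem_coe]
    beta_reduce
    rw [h2]
    exact add_mem (Submodule.mem_sup_left (neg_mem hmem))
      (Submodule.mem_sup_right (pow_le_pow_left' (initSpan_mono y (Nat.le_succ i)) 2 h1))
  · simp only [SetLike.mem_coe, h.exch i k hi hk hp]
    exact Submodule.mem_sup_left (Submodule.smul_mem _ _ hmem)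

lemma sq_mem {k : ℕ} (hk : k < N) : y k * y k ∈ initSpan y k ^ 2 := by
  by_cases he : Even k
  · exact h.sq_even k hk he
  · rw [h.sq_odd k hk he]; exact zero_mem _

lemma initSpan_succ_pow_le {k : ℕ} (hk : k < N) (d : ℕ) :
    initSpan y (k + 1) ^ (d + 1) ≤
      initSpan y k ^ (d + 1) ⊔ initSpan y k ^ d * Submodule.span ℂ {y k} := by
  rw [initSpan_succ]
  refine sup_pow_le (h.span_mul_initSpan_le hk) ?_ d
  rw [Submodule.span_mul_span, Submodule.span_le]
  simpa using h.sq_mem hk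

/-- A word contains the newest generator at most once, at its end. Deleting it leaves a word in one
generator fewer, of degree one less, so both claims descend to `k`. -/
lemma initSpan_pow {k : ℕ} (hk : k ≤ N) :
    initSpan y k ^ (k + 1) = ⊥ ∧ initSpan y k ^ k ≤ Submodule.span ℂ {initProd y k} := by
  induction k with
  | zero => simp [initSpan_zero, initProd, Submodule.one_eq_span]
  | succ k ih =>
    obtain ⟨h0, h1⟩ := ih (by omega)
    constructor
    · rw [eq_bot_iff]
      refine (h.initSpan_succ_pow_le hk (k + 1)).trans ?_
      rw [pow_succ, h0]; simp
    · refine (h.initSpan_succ_pow_le hk k).trans ?_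
      rw [h0, bot_sup_eq]
      refine (mul_le_mul_left h1 _).trans ?_
      rw [Submodule.span_mul_span]; simp [initProd]

lemma eq_zero_of_mem {k : ℕ} (hk : k ≤ N) {u : A} (hu : u ∈ initSpan y k ^ (k + 1)) : u = 0 := by
  rwa [(h.initSpan_pow hk).1, Submodule.mem_bot] at hu

lemma eq_zero_of_mem_pow {k d : ℕ} (hk : k ≤ N) (hd : k < d) {u : A}
    (hu : u ∈ initSpan y k ^ d) : u = 0 := by
  obtain ⟨c, rfl⟩ := Nat.exists_eq_add_of_lt hd
  rw [show k + c + 1 = k + 1 + c by ring, pow_add, (h.initSpan_pow hk).1] at hu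
  simpa using hu

/-- A generator moves past powers of the span of the earlier pairs. -/
lemma mul_pow_mem {j m d : ℕ} (hj : j < N) (hmj : m ≤ j) (hm : Even m) {u : A}
    (hu : u ∈ initSpan y m ^ d) : ∃ v ∈ initSpan y m ^ d, y j * u = v * y j := by
  have hle : Submodule.span ℂ {y j} * initSpan y m ≤ initSpan y m * Submodule.span ℂ {y j} := by
    rw [initSpan, Submodule.span_mul_span, Submodule.span_le]
    rintro _ ⟨_, rfl, _, ⟨i, hi, rfl⟩, rfl⟩
    have hi : i < m := hi
    have hp : ¬ (Even i ∧ j = i + 1) := by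
      rintro ⟨he, rfl⟩
      obtain ⟨a, rfl⟩ := he
      obtain ⟨b, rfl⟩ := hm
      omega
    simp only [SetLike.mem_coe, h.exch i j (by omega) hj hp]
    exact Submodule.smul_mem _ _ (Submodule.mul_mem_mul (mem_initSpan y hi)
      (Submodule.mem_span_singleton_self _))
  have hmem := mul_pow_le_of_mul_le hle d
    (Submodule.mul_mem_mul (Submodule.mem_span_singleton_self (y j)) hu)
  obtain ⟨v, hv, e⟩ := Submodule.mem_mul_span_singleton.1 hmem
  exact ⟨v, hv, e.symm⟩

/-- The ordered product of complete pairs commutes with the later generators. -/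
lemma mul_initProd_even (hq : q ≠ 0) {j : ℕ} (hj : j < N) (m : ℕ) (hmj : 2 * m ≤ j) :
    y j * initProd y (2 * m) = initProd y (2 * m) * y j := by
  induction m with
  | zero => simp [initProd]
  | succ m ih =>
    have e0 := h.exch (2 * m) j (by omega) hj (by omega)
    have e1 := h.exch (2 * m + 1) j (by omega) hj (by simp [parity_simps])
    have hs : initProd y (2 * (m + 1)) = initProd y (2 * m) * y (2 * m) * y (2 * m + 1) := rfl
    have ho : ¬ Even (2 * m + 1) := by simp [parity_simps]
    rw [exchange, if_pos (even_two_mul m)] at e0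
    rw [exchange, if_neg ho] at e1
    calc y j * initProd y (2 * (m + 1))
        = (y j * initProd y (2 * m)) * y (2 * m) * y (2 * m + 1) := by rw [hs]; noncomm_ring
      _ = initProd y (2 * m) * (y j * y (2 * m)) * y (2 * m + 1) := by
        rw [ih (by omega)]; noncomm_ring
      _ = (-q) • (initProd y (2 * m) * y (2 * m) * (y j * y (2 * m + 1))) := by
        rw [e0]; simp only [mul_smul_comm, smul_mul_assoc, mul_assoc]
      _ = initProd y (2 * (m + 1)) * y j := by
        rw [e1, hs, mul_smul_comm, smul_smul, neg_mul_neg, mul_inv_cancel₀ hq, one_smul]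
        simp only [mul_assoc]

/-- The ordered product of the earlier generators commutes with a generator that opens a pair and
anticommutes with one that closes it. -/
lemma mul_initProd (hq : q ≠ 0) {k : ℕ} (hk : k < N) :
    y k * initProd y k = (if Even k then (1 : ℂ) else -1) • (initProd y k * y k) := by
  split_ifs with he
  · obtain ⟨m, rfl⟩ := he.two_dvd
    rw [one_smul, h.mul_initProd_even hq hk m le_rfl]
  · obtain ⟨m, rfl⟩ := Nat.not_even_iff_odd.1 he
    have h1 := h.pair (2 * m) (even_two_mul m) hk
    have hT : initProd y (2 * m) ∈ initSpan y (2 * m) ^ (2 * m) := by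
      have : ∀ k, initProd y k ∈ initSpan y k ^ k := by
        intro k
        induction k with
        | zero => exact Submodule.one_le.1 le_rfl
        | succ k ih =>
          rw [pow_succ]
          exact Submodule.mul_mem_mul (pow_le_pow_left' (initSpan_mono y k.le_succ) k ih)
            (mem_initSpan y k.lt_succ_self)
      exact this _
    -- The anticommutator is quadratic in the first `2 * m` generators, so the product has degree `2
    -- * m + 2` in them and vanishes.
    have h2 : initProd y (2 * m) * (y (2 * m + 1) * y (2 * m) + y (2 * m) * y (2 * m + 1)) = 0 := by
      refine h.eq_zero_of_mem_pow (k := 2 * m) (d := 2 * m + 2) (by omega) (by omega) ?_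
      rw [pow_add]
      exact Submodule.mul_mem_mul hT h1
    have hs : initProd y (2 * m + 1) = initProd y (2 * m) * y (2 * m) := rfl
    rw [hs, ← mul_assoc, h.mul_initProd_even hq hk m (by omega), neg_one_smul,
      ← add_eq_zero_iff_eq_neg, mul_assoc, mul_assoc, ← mul_add, h2]

/-- Two copies of the last generator annihilate everything of one degree below the top. -/
lemma mul_mul_self_eq_zero {k : ℕ} (hk : k + 1 < N) {u : A} (hu : u ∈ initSpan y (k + 1) ^ k) :
    y (k + 1) * u * y (k + 1) = 0 := by
  -- For even `k + 1` all earlier generators form complete pairs, and the two copies can be brought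
  -- together directly. For odd `k + 1` the partner `y k` stands in the way.
  by_cases he : Even (k + 1)
  · obtain ⟨v, hv, e⟩ := h.mul_pow_mem hk le_rfl he hu
    rw [e, mul_assoc]
    refine h.eq_zero_of_mem_pow (k := k + 1) (d := k + 2) hk.le (by omega) ?_
    rw [pow_add]
    exact Submodule.mul_mem_mul hv (h.sq_even _ hk he)
  · have hek : Even k := by simpa [parity_simps] using he
    have hsq := h.sq_odd _ hk he
    -- Degree zero is separate: the decomposition of `u` below requires a positive exponent.
    rcases k with _ | k
    · obtain ⟨c, rfl⟩ := Submodule.mem_one.1 (by simpa using hu)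
      rw [← Algebra.commutes, mul_assoc, hsq, mul_zero]
    obtain ⟨u1, hu1, u2, hu2, rfl⟩ :=
      Submodule.mem_sup.1 (h.initSpan_succ_pow_le (k := k + 1) (by omega) k hu)
    obtain ⟨r, hr, rfl⟩ := Submodule.mem_mul_span_singleton.1 hu2
    obtain ⟨v1, hv1, e1⟩ := h.mul_pow_mem hk (by omega) hek hu1
    obtain ⟨v2, hv2, e2⟩ := h.mul_pow_mem hk (by omega) hek hr
    have hw := h.pair _ hek hk
    set a := y (k + 1)
    set b := y (k + 1 + 1)
    -- Degree `k + 2` in `k + 1` generators. Hence `v2 * b * a * b` equals `-(v2 * a * b * b)`,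
    -- which ends in a square.
    have hz : v2 * (b * a + a * b) = 0 := by
      refine h.eq_zero_of_mem_pow (k := k + 1) (d := k + 2) (by omega) (by omega) ?_
      rw [pow_add]
      exact Submodule.mul_mem_mul hv2 hw
    calc b * (u1 + r * a) * b = (b * u1) * b + (b * r) * a * b := by noncomm_ring
      _ = v1 * (b * b) + v2 * (b * a + a * b) * b - v2 * a * (b * b) := by
        rw [e1, e2]; noncomm_ring
      _ = 0 := by rw [hsq, hz]; simp

end IsTower

/-- The factor relating left and right multiplication by generator number `i` on forms of degree
`k - 1` in the first `k` generators. -/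
def cyclicFactor (q : ℂ) (k i : ℕ) : ℂ :=
  if Even i then (if k = i + 1 then 1 else -(-q⁻¹) ^ (k - i - 2)) else -(-q) ^ (k - i - 1)

/-- Inductive step of the cyclic property: a new generator at the end of the form, not the partner
of generator `i`, must be exchanged with it once. -/
lemma cyclicFactor_succ {q : ℂ} (hq : q ≠ 0) {k i : ℕ} (hik : i < k)
    (hp : ¬ (Even i ∧ k = i + 1)) :
    cyclicFactor q (k + 1) i * exchange q i = cyclicFactor q k i := by
  unfold cyclicFactor exchange
  by_cases he : Even i
  · have hk : k ≠ i + 1 := fun hk => hp ⟨he, hk⟩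
    obtain ⟨c, rfl⟩ : ∃ c, k = i + 2 + c := ⟨k - i - 2, by omega⟩
    rw [if_pos he, if_pos he, if_pos he, if_neg (by omega), if_neg hk,
      show i + 2 + c + 1 - i - 2 = c + 1 by omega, show i + 2 + c - i - 2 = c by omega, pow_succ]
    field_simp
  · obtain ⟨c, rfl⟩ : ∃ c, k = i + 1 + c := ⟨k - i - 1, by omega⟩
    rw [if_neg he, if_neg he, if_neg he,
      show i + 1 + c + 1 - i - 1 = c + 1 by omega, show i + 1 + c - i - 1 = c by omega, pow_succ]
    field_simp

namespace IsTower

variable {q : ℂ} {N : ℕ} {y : ℕ → A} (h : IsTower q N y)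
include h

/-- The cyclic property of the top degree. -/
theorem mul_eq_cyclicFactor_smul (hq : q ≠ 0) {k : ℕ} (hk : k < N) {i : ℕ} (hi : i ≤ k) {u : A}
    (hu : u ∈ initSpan y (k + 1) ^ k) :
    y i * u = cyclicFactor q (k + 1) i • (u * y i) := by
  induction k generalizing i u with
  | zero =>
    obtain rfl : i = 0 := by omega
    obtain ⟨c, rfl⟩ := Submodule.mem_one.1 (by simpa using hu)
    simp [cyclicFactor, Algebra.commutes]
  | succ k ih =>
    obtain ⟨p, hpm, p2, hp2, rfl⟩ := Submodule.mem_sup.1 (h.initSpan_succ_pow_le hk k hu)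
    obtain ⟨r, hr, rfl⟩ := Submodule.mem_mul_span_singleton.1 hp2
    -- For an earlier generator `p` contributes nothing by degree and induction handles `r`. For the
    -- newest generator the `r` term dies instead, and `p` is a multiple of the ordered product.
    rcases Nat.lt_or_eq_of_le hi with hi | rfl
    · have hyi := mem_initSpan y hi
      have z1 : y i * p = 0 :=
        h.eq_zero_of_mem hk.le (by rw [pow_succ']; exact Submodule.mul_mem_mul hyi hpm)
      have z2 : p * y i = 0 :=
        h.eq_zero_of_mem hk.le (by rw [pow_succ]; exact Submodule.mul_mem_mul hpm hyi)
      have e1 := ih (by omega) (Nat.lt_succ_iff.1 hi) hr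
      rw [mul_add, z1, zero_add, add_mul, z2, zero_add, ← mul_assoc, e1]
      by_cases hp : Even i ∧ k + 1 = i + 1
      · obtain ⟨he, hki⟩ := hp
        obtain rfl : k = i := by omega
        have hz : r * (y (k + 1) * y k + y k * y (k + 1)) = 0 := by
          refine h.eq_zero_of_mem_pow (k := k + 1) (d := k + 2) hk.le (by omega) ?_
          rw [pow_add]
          exact Submodule.mul_mem_mul hr
            (pow_le_pow_left' (initSpan_mono y k.le_succ) 2 (h.pair k he hk))
        have hz' : r * y (k + 1) * y k = -(r * y k * y (k + 1)) := by
          rw [← add_eq_zero_iff_eq_neg, mul_assoc, mul_assoc, ← mul_add, hz]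
        rw [hz', cyclicFactor, cyclicFactor, if_pos he, if_pos he, if_pos rfl, if_neg (by omega),
          show k + 1 + 1 - k - 2 = 0 by omega, pow_zero, one_smul, neg_one_smul, neg_neg]
      · rw [mul_assoc r, h.exch i (k + 1) hi hk hp, ← cyclicFactor_succ hq hi hp]
        simp only [mul_smul_comm, smul_mul_assoc, smul_smul, mul_assoc]
    · have z1 := h.mul_mul_self_eq_zero hk hr
      have z2 : r * (y (k + 1) * y (k + 1)) = 0 := by
        refine h.eq_zero_of_mem_pow (k := k + 1) (d := k + 2) hk.le (by omega) ?_
        rw [pow_add]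
        exact Submodule.mul_mem_mul hr (h.sq_mem hk)
      obtain ⟨c, rfl⟩ := Submodule.mem_span_singleton.1 ((h.initSpan_pow hk.le).2 hpm)
      rw [mul_add, ← mul_assoc, z1, add_mul, mul_assoc r, z2, add_zero, add_zero, mul_smul_comm,
        h.mul_initProd hq hk, smul_mul_assoc, smul_comm]
      congr 1
      simp [cyclicFactor]

end IsTower

end Tower

/-! ### Systems of conjugate pairs and their quadratic element. -/

section PairSystem

variable {B : Type*} [Ring B]

/-- The product `b (k - 1) * ⋯ * b 0`. -/
def revProd (b : ℕ → B) : ℕ → B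
  | 0 => 1
  | k + 1 => b k * revProd b k

lemma initProd_congr {a a' : ℕ → B} {k : ℕ} (h : ∀ i < k, a i = a' i) :
    initProd a k = initProd a' k := by
  induction k with
  | zero => rfl
  | succ k ih => rw [initProd, initProd, ih fun i hi => h i (by omega), h k (by omega)]

lemma revProd_congr {b b' : ℕ → B} {k : ℕ} (h : ∀ i < k, b i = b' i) :
    revProd b k = revProd b' k := by
  induction k with
  | zero => rfl
  | succ k ih => rw [revProd, revProd, ih fun i hi => h i (by omega), h k (by omega)]

variable [Algebra ℂ B]

/-- The quadratic element `∑_{k < n} q ^ k a_k b_k`. -/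
def pairSum (q : ℂ) (a b : ℕ → B) : ℕ → B
  | 0 => 0
  | k + 1 => pairSum q a b k + q ^ k • (a k * b k)

/-- The relations between the differentials `a_k = dx^k`, `b_k = dx^{k'}` with `k < n ≤ N / 2`. -/
structure IsPairSystem (q : ℂ) (n : ℕ) (a b : ℕ → B) : Prop where
  a_sq : ∀ i < n, a i * a i = 0
  b_sq : ∀ i < n, b i * b i = 0
  aa : ∀ i j, i < j → j < n → a j * a i = (-q) • (a i * a j)
  ab : ∀ i j, i < j → j < n → a j * b i = (-q⁻¹) • (b i * a j)
  ba : ∀ i j, i < j → j < n → b j * a i = (-q) • (a i * b j)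
  bb : ∀ i j, i < j → j < n → b j * b i = (-q⁻¹) • (b i * b j)
  hyp : ∀ i < n, b i * a i + a i * b i = ((q ^ 2 - 1) * (q ^ i)⁻¹) • pairSum q a b i

lemma pairSum_congr (q : ℂ) {a a' b b' : ℕ → B} {k : ℕ} (h : ∀ i < k, a i = a' i)
    (h' : ∀ i < k, b i = b' i) : pairSum q a b k = pairSum q a' b' k := by
  induction k with
  | zero => rfl
  | succ k ih =>
    rw [pairSum, pairSum, ih (fun i hi => h i (by omega)) fun i hi => h' i (by omega),
      h k (by omega), h' k (by omega)]

lemma map_initProd {B' : Type*} [Ring B'] [Algebra ℂ B'] (f : B →ₐ[ℂ] B') (a : ℕ → B) (k : ℕ) :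
    initProd (fun i => f (a i)) k = f (initProd a k) := by
  induction k with
  | zero => simp [initProd]
  | succ k ih => simp [initProd, ih]

lemma map_revProd {B' : Type*} [Ring B'] [Algebra ℂ B'] (f : B →ₐ[ℂ] B') (a : ℕ → B) (k : ℕ) :
    revProd (fun i => f (a i)) k = f (revProd a k) := by
  induction k with
  | zero => simp [revProd]
  | succ k ih => simp [revProd, ih]

lemma map_pairSum {B' : Type*} [Ring B'] [Algebra ℂ B'] (f : B →ₐ[ℂ] B') (q : ℂ) (a b : ℕ → B)
    (k : ℕ) : pairSum q (fun i => f (a i)) (fun i => f (b i)) k = f (pairSum q a b k) := by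
  induction k with
  | zero => simp [pairSum]
  | succ k ih => simp [pairSum, ih]

lemma mul_revProd {b : ℕ → B} {s : B} {c : ℂ} {k : ℕ} (h : ∀ j < k, s * b j = c • (b j * s)) :
    s * revProd b k = c ^ k • (revProd b k * s) := by
  induction k with
  | zero => simp [revProd]
  | succ k ih =>
    rw [revProd, ← mul_assoc, h k (by omega), smul_mul_assoc, mul_assoc,
      ih fun j hj => h j (by omega), mul_smul_comm, smul_smul, ← pow_succ', mul_assoc]

/-- An element which scales `a_k` and `b_k` by inverse factors commutes with `pairSum`. -/
lemma mul_pairSum {q c : ℂ} (hc : c ≠ 0) {a b : ℕ → B} {s : B} {k : ℕ}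
    (ha : ∀ j < k, s * a j = c • (a j * s)) (hb : ∀ j < k, s * b j = c⁻¹ • (b j * s)) :
    s * pairSum q a b k = pairSum q a b k * s := by
  induction k with
  | zero => simp [pairSum]
  | succ k ih =>
    rw [pairSum, mul_add, add_mul, ih (fun j hj => ha j (by omega)) fun j hj => hb j (by omega),
      mul_smul_comm, ← mul_assoc, ha k (by omega), smul_mul_assoc, mul_assoc, hb k (by omega),
      mul_smul_comm, smul_smul c, mul_inv_cancel₀ hc, one_smul, smul_mul_assoc, mul_assoc]

namespace IsPairSystem

variable {q : ℂ} {n : ℕ} {a b : ℕ → B} (h : IsPairSystem q n a b)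
include h

lemma a_mul_pairSum (hq : q ≠ 0) {k : ℕ} (hk : k < n) :
    a k * pairSum q a b k = pairSum q a b k * a k :=
  mul_pairSum (neg_ne_zero.2 hq) (fun j hj => h.aa j k hj hk)
    fun j hj => by rw [h.ab j k hj hk, inv_neg]

lemma b_mul_pairSum (hq : q ≠ 0) {k : ℕ} (hk : k < n) :
    b k * pairSum q a b k = pairSum q a b k * b k :=
  mul_pairSum (neg_ne_zero.2 hq) (fun j hj => h.ba j k hj hk)
    fun j hj => by rw [h.bb j k hj hk, inv_neg]

/-- For a pair before the last, each later summand contributes `(-q) * (-q)`. For the last pair,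
`pairSum` of the earlier pairs commutes with `a j`, and `a j * b j * a j` supplies the missing `q ^
2 - 1` through `hyp`. -/
lemma pairSum_mul_a (hq : q ≠ 0) {k j : ℕ} (hk : k ≤ n) (hj : j < k) :
    pairSum q a b k * a j = q ^ 2 • (a j * pairSum q a b k) := by
  induction k with
  | zero => omega
  | succ k ih =>
    rcases Nat.lt_or_eq_of_le (Nat.lt_succ_iff.1 hj) with hj | rfl
    · rw [pairSum, add_mul, ih (by omega) hj, mul_add, smul_add, smul_mul_assoc, mul_assoc,
        h.ba j k hj hk, mul_smul_comm, ← mul_assoc, h.aa j k hj hk, mul_smul_comm]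
      simp only [smul_smul, smul_mul_assoc, mul_assoc]
      congr 2
      ring
    · have h1 : b j * a j = ((q ^ 2 - 1) * (q ^ j)⁻¹) • pairSum q a b j - a j * b j :=
        eq_sub_of_add_eq (h.hyp j hk)
      have hqj : q ^ j ≠ 0 := pow_ne_zero _ hq
      have e : a j * b j * a j = ((q ^ 2 - 1) * (q ^ j)⁻¹) • (a j * pairSum q a b j) := by
        rw [mul_assoc, h1, mul_sub, ← mul_assoc (a j) (a j), h.a_sq j hk, zero_mul, sub_zero,
          mul_smul_comm]
      have e2 : a j * (a j * b j) = 0 := by rw [← mul_assoc, h.a_sq j hk, zero_mul]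
      rw [pairSum, add_mul, ← h.a_mul_pairSum hq hk, smul_mul_assoc, e, mul_add, mul_smul_comm,
        e2, smul_zero, add_zero, smul_smul]
      nth_rw 1 [← one_smul ℂ (a j * pairSum q a b j)]
      rw [← add_smul]
      congr 1
      field_simp
      ring

lemma pairSum_mul_b (hq : q ≠ 0) {k j : ℕ} (hk : k ≤ n) (hj : j < k) :
    pairSum q a b k * b j = (q ^ 2)⁻¹ • (b j * pairSum q a b k) := by
  induction k with
  | zero => omega
  | succ k ih =>
    rcases Nat.lt_or_eq_of_le (Nat.lt_succ_iff.1 hj) with hj | rfl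
    · rw [pairSum, add_mul, ih (by omega) hj, mul_add, smul_add, smul_mul_assoc, mul_assoc,
        h.bb j k hj hk, mul_smul_comm, ← mul_assoc, h.ab j k hj hk, mul_smul_comm]
      simp only [smul_smul, smul_mul_assoc, mul_assoc]
      congr 2
      field_simp
    · have h1 : a j * b j = ((q ^ 2 - 1) * (q ^ j)⁻¹) • pairSum q a b j - b j * a j :=
        eq_sub_of_add_eq (by rw [add_comm]; exact h.hyp j hk)
      have hqj : q ^ j ≠ 0 := pow_ne_zero _ hq
      have e : b j * (a j * b j) = ((q ^ 2 - 1) * (q ^ j)⁻¹) • (b j * pairSum q a b j) := by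
        rw [h1, mul_sub, ← mul_assoc (b j) (b j), h.b_sq j hk, zero_mul, sub_zero,
          mul_smul_comm]
      have e2 : a j * b j * b j = 0 := by rw [mul_assoc, h.b_sq j hk, mul_zero]
      rw [pairSum, add_mul, ← h.b_mul_pairSum hq hk, smul_mul_assoc, e2, mul_add, mul_smul_comm,
        e, smul_zero, add_zero, smul_smul]
      nth_rw 2 [← one_smul ℂ (b j * pairSum q a b j)]
      rw [← add_smul, smul_smul]
      nth_rw 1 [← one_smul ℂ (b j * pairSum q a b j)]
      congr 1
      field_simp
      ring

end IsPairSystem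

/-- A pair system together with an invertible element implementing the scaling automorphism by
which a further generator moves past the pairs. -/
structure IsTwistedPairSystem (q : ℂ) (n : ℕ) (a b : ℕ → B) (s t : B) : Prop
    extends IsPairSystem q n a b where
  s_mul_t : s * t = 1
  t_mul_s : t * s = 1
  s_mul_a : ∀ j < n, s * a j = (-q) • (a j * s)
  s_mul_b : ∀ j < n, s * b j = (-q⁻¹) • (b j * s)

/-- A pair system extends by one pair along a homomorphism `f`. -/
lemma IsTwistedPairSystem.extend {B' : Type*} [Ring B'] [Algebra ℂ B'] {q : ℂ} {n : ℕ}
    {a b : ℕ → B} {s t : B} (h : IsTwistedPairSystem q n a b s t) (f : B →ₐ[ℂ] B')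
    {α β s' t' : B'} (hαα : α * α = 0) (hββ : β * β = 0)
    (hβα : β * α + α * β = ((q ^ 2 - 1) * (q ^ n)⁻¹) • f (pairSum q a b n))
    (hαa : ∀ j < n, α * f (a j) = (-q) • (f (a j) * α))
    (hαb : ∀ j < n, α * f (b j) = (-q⁻¹) • (f (b j) * α))
    (hβa : ∀ j < n, β * f (a j) = (-q) • (f (a j) * β))
    (hβb : ∀ j < n, β * f (b j) = (-q⁻¹) • (f (b j) * β))
    (hst : s' * t' = 1) (hts : t' * s' = 1)
    (hsα : s' * α = (-q) • (α * s')) (hsβ : s' * β = (-q⁻¹) • (β * s'))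
    (hsa : ∀ j < n, s' * f (a j) = (-q) • (f (a j) * s'))
    (hsb : ∀ j < n, s' * f (b j) = (-q⁻¹) • (f (b j) * s')) :
    IsTwistedPairSystem q (n + 1) (fun i => if i < n then f (a i) else α)
      (fun i => if i < n then f (b i) else β) s' t' := by
  have key : ∀ {P : ℕ → Prop}, (∀ i < n, P i) → P n → ∀ i < n + 1, P i := by
    intro P h1 h2 i hi
    rcases Nat.lt_or_eq_of_le (Nat.lt_succ_iff.1 hi) with hi | rfl
    exacts [h1 i hi, h2]
  have hsum : ∀ i ≤ n, pairSum q (fun i => if i < n then f (a i) else α)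
      (fun i => if i < n then f (b i) else β) i = f (pairSum q a b i) := by
    intro i hi
    rw [← map_pairSum]
    exact pairSum_congr q (fun j hj => if_pos (by omega)) fun j hj => if_pos (by omega)
  refine ⟨⟨key ?_ ?_, key ?_ ?_, ?_, ?_, ?_, ?_, key ?_ ?_⟩, hst, hts, key ?_ ?_, key ?_ ?_⟩
  · intro i hi; simp only [hi, if_true, ← map_mul, h.a_sq i hi, map_zero]
  · simpa using hαα
  · intro i hi; simp only [hi, if_true, ← map_mul, h.b_sq i hi, map_zero]
  · simpa using hββ
  · intro i j hij hj
    have hi : i < n := by omega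
    rcases Nat.lt_or_eq_of_le (Nat.lt_succ_iff.1 hj) with hj | rfl
    · simp only [hi, hj, if_true, ← map_mul, h.aa i j hij hj, map_smul]
    · simpa [hi] using hαa i hi
  · intro i j hij hj
    have hi : i < n := by omega
    rcases Nat.lt_or_eq_of_le (Nat.lt_succ_iff.1 hj) with hj | rfl
    · simp only [hi, hj, if_true, ← map_mul, h.ab i j hij hj, map_smul]
    · simpa [hi] using hαb i hi
  · intro i j hij hj
    have hi : i < n := by omega
    rcases Nat.lt_or_eq_of_le (Nat.lt_succ_iff.1 hj) with hj | rfl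
    · simp only [hi, hj, if_true, ← map_mul, h.ba i j hij hj, map_smul]
    · simpa [hi] using hβa i hi
  · intro i j hij hj
    have hi : i < n := by omega
    rcases Nat.lt_or_eq_of_le (Nat.lt_succ_iff.1 hj) with hj | rfl
    · simp only [hi, hj, if_true, ← map_mul, h.bb i j hij hj, map_smul]
    · simpa [hi] using hβb i hi
  · intro i hi
    rw [hsum i hi.le]
    simp only [hi, if_true, ← map_mul, ← map_add, h.hyp i hi, map_smul]
  · rw [hsum n le_rfl]
    simpa using hβα
  · intro i hi; simpa [hi] using hsa i hi
  · simpa using hsα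
  · intro i hi; simpa [hi] using hsb i hi
  · simpa using hsβ

end PairSystem

/-! ### Construction of pair systems with nonzero ordered product. -/

section Realization

/-- Multiplication by `α` on the exterior algebra with basis `1, α, β, αβ`. -/
def extMulA : Matrix (Fin 4) (Fin 4) ℂ := !![0, 0, 0, 0; 1, 0, 0, 0; 0, 0, 0, 0; 0, 0, 1, 0]

/-- Multiplication by `β` on the exterior algebra with basis `1, α, β, αβ`. -/
def extMulB : Matrix (Fin 4) (Fin 4) ℂ := !![0, 0, 0, 0; 0, 0, 0, 0; 1, 0, 0, 0; 0, -1, 0, 0]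

/-- The derivation `∂/∂α` on the exterior algebra with basis `1, α, β, αβ`. -/
def extDerA : Matrix (Fin 4) (Fin 4) ℂ := !![0, 1, 0, 0; 0, 0, 0, 0; 0, 0, 0, 1; 0, 0, 0, 0]

/-- The automorphism scaling `α` by `x` and `β` by `y`. -/
def extScale (x y : ℂ) : Matrix (Fin 4) (Fin 4) ℂ :=
  !![1, 0, 0, 0; 0, x, 0, 0; 0, 0, y, 0; 0, 0, 0, x * y]

lemma extMulA_sq : extMulA * extMulA = 0 := by
  ext i j; fin_cases i <;> fin_cases j <;> simp [extMulA, Matrix.mul_apply, Fin.sum_univ_four]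

lemma extMulB_sq : extMulB * extMulB = 0 := by
  ext i j; fin_cases i <;> fin_cases j <;> simp [extMulB, Matrix.mul_apply, Fin.sum_univ_four]

lemma extDerA_sq : extDerA * extDerA = 0 := by
  ext i j; fin_cases i <;> fin_cases j <;> simp [extDerA, Matrix.mul_apply, Fin.sum_univ_four]

lemma extMulB_mul_extMulA : extMulB * extMulA = -(extMulA * extMulB) := by
  ext i j; fin_cases i <;> fin_cases j <;>
    simp [extMulA, extMulB, Matrix.mul_apply, Fin.sum_univ_four]

lemma extDerA_mul_extMulB : extDerA * extMulB = -(extMulB * extDerA) := by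
  ext i j; fin_cases i <;> fin_cases j <;>
    simp [extDerA, extMulB, Matrix.mul_apply, Fin.sum_univ_four]

lemma extDerA_mul_extMulA : extDerA * extMulA = 1 - extMulA * extDerA := by
  ext i j; fin_cases i <;> fin_cases j <;>
    simp [extDerA, extMulA, Matrix.mul_apply, Fin.sum_univ_four]

lemma extScale_mul_extMulA (x y : ℂ) :
    extScale x y * extMulA = x • (extMulA * extScale x y) := by
  ext i j; fin_cases i <;> fin_cases j <;>
    simp [extScale, extMulA, Matrix.mul_apply, Fin.sum_univ_four]

lemma extScale_mul_extMulB (x y : ℂ) :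
    extScale x y * extMulB = y • (extMulB * extScale x y) := by
  ext i j; fin_cases i <;> fin_cases j <;>
    simp [extScale, extMulB, Matrix.mul_apply, Fin.sum_univ_four, mul_comm]

lemma extScale_mul_extDerA {x : ℂ} (hx : x ≠ 0) (y : ℂ) :
    extScale x y * extDerA = x⁻¹ • (extDerA * extScale x y) := by
  ext i j; fin_cases i <;> fin_cases j <;>
    simp [extScale, extDerA, Matrix.mul_apply, Fin.sum_univ_four, hx]

lemma extScale_mul_inv {x y : ℂ} (hx : x ≠ 0) (hy : y ≠ 0) :
    extScale x y * extScale x⁻¹ y⁻¹ = 1 := by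
  ext i j; fin_cases i <;> fin_cases j <;>
    simp [extScale, Matrix.mul_apply, Fin.sum_univ_four, hx, hy, mul_mul_mul_comm x y]

open scoped TensorProduct in
/-- Extension of a twisted pair system by one pair, inside the tensor product with the
endomorphisms of an exterior algebra on two generators. -/
lemma IsTwistedPairSystem.exists_extend {B : Type} [Ring B] [Algebra ℂ B] {q : ℂ} (hq : q ≠ 0)
    {n : ℕ} {a b : ℕ → B} {s t : B} (h : IsTwistedPairSystem q n a b s t)
    (hne : initProd a n * revProd b n ≠ 0) :
    ∃ (B' : Type) (_ : Ring B') (_ : Algebra ℂ B') (a' b' : ℕ → B') (s' t' : B'),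
      IsTwistedPairSystem q (n + 1) a' b' s' t' ∧
        initProd a' (n + 1) * revProd b' (n + 1) ≠ 0 := by
  have hq' : -q ≠ 0 := neg_ne_zero.2 hq
  have hqi : -q⁻¹ ≠ 0 := neg_ne_zero.2 (inv_ne_zero hq)
  have hts := h.t_mul_s
  have hst := h.s_mul_t
  set Ω := pairSum q a b n with hΩ
  set c : ℂ := (q ^ 2 - 1) * (q ^ n)⁻¹ with hc
  have hsΩ : s * Ω = Ω * s :=
    mul_pairSum hq' h.s_mul_a fun j hj => by rw [h.s_mul_b j hj, inv_neg]
  have t_mul : ∀ {x : B} {d : ℂ}, d ≠ 0 → s * x = d • (x * s) → t * x = d⁻¹ • (x * t) := by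
    intro x d hd hx
    calc t * x = d⁻¹ • (t * (d • (x * s)) * t) := by
          rw [mul_smul_comm, smul_mul_assoc, smul_smul, inv_mul_cancel₀ hd, one_smul,
            mul_assoc, mul_assoc, hst, mul_one]
      _ = d⁻¹ • (x * t) := by rw [← hx, ← mul_assoc, hts, one_mul]
  have htΩ : t * Ω = Ω * t := by
    simpa using t_mul (x := Ω) (d := 1) one_ne_zero (by rw [hsΩ, one_smul])
  -- Since `Ω` scales `a j` by `q ^ 2` and `t` by `(-q)⁻¹`, `p` scales `a j` by `-q`, exactly as `s`
  -- does; likewise for `b j`. The two terms of `β` below therefore move past old generators with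
  -- the same factor.
  set p := t * Ω with hp
  have hsp : s * p = Ω := by rw [hp, ← mul_assoc, hst, one_mul]
  have hps : p * s = Ω := by rw [htΩ, mul_assoc, hts, mul_one]
  have hpa : ∀ j < n, p * a j = (-q) • (a j * p) := by
    intro j hj
    rw [hp, mul_assoc, h.pairSum_mul_a hq le_rfl hj, mul_smul_comm, ← mul_assoc,
      t_mul hq' (h.s_mul_a j hj), smul_mul_assoc, smul_smul, mul_assoc]
    congr 1
    field_simp
  have hpb : ∀ j < n, p * b j = (-q⁻¹) • (b j * p) := by
    intro j hj
    rw [hp, mul_assoc, h.pairSum_mul_b hq le_rfl hj, mul_smul_comm, ← mul_assoc,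
      t_mul hqi (h.s_mul_b j hj), smul_mul_assoc, smul_smul, mul_assoc]
    congr 1
    field_simp
  let M := Matrix (Fin 4) (Fin 4) ℂ
  let f : B →ₐ[ℂ] B ⊗[ℂ] M := Algebra.TensorProduct.includeLeft
  have hf : ∀ x, f x = x ⊗ₜ[ℂ] (1 : M) := fun _ => rfl
  let α : B ⊗[ℂ] M := s ⊗ₜ[ℂ] extMulA
  -- In `β * α + α * β` the `extMulB` terms cancel, while `extDerA * extMulA + extMulA * extDerA =
  -- 1` and `s * p = p * s = Ω` turn the derivation term into `c • f Ω`.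
  let β : B ⊗[ℂ] M := s ⊗ₜ[ℂ] extMulB + c • (p ⊗ₜ[ℂ] extDerA)
  let s' : B ⊗[ℂ] M := s ⊗ₜ[ℂ] extScale (-q) (-q⁻¹)
  let t' : B ⊗[ℂ] M := t ⊗ₜ[ℂ] extScale (-q)⁻¹ (-q⁻¹)⁻¹
  have hα : α = s ⊗ₜ[ℂ] extMulA := rfl
  have hβ : β = s ⊗ₜ[ℂ] extMulB + c • (p ⊗ₜ[ℂ] extDerA) := rfl
  have hs' : s' = s ⊗ₜ[ℂ] extScale (-q) (-q⁻¹) := rfl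
  have move : ∀ {x y : B} {d : ℂ} (m : M), x * y = d • (y * x) →
      x ⊗ₜ[ℂ] m * f y = d • (f y * x ⊗ₜ[ℂ] m) := by
    intro x y d m hxy
    rw [hf, Algebra.TensorProduct.tmul_mul_tmul, Algebra.TensorProduct.tmul_mul_tmul, hxy,
      one_mul, mul_one, TensorProduct.smul_tmul']
  have moveβ : ∀ {y : B} {d : ℂ}, s * y = d • (y * s) → p * y = d • (y * p) →
      β * f y = d • (f y * β) := by
    intro y d h1 h2
    rw [hβ, add_mul, mul_add, smul_mul_assoc, move _ h1, move _ h2, mul_smul_comm, smul_add,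
      smul_comm c d]
  refine ⟨B ⊗[ℂ] M, inferInstance, inferInstance, _, _, s', t',
    h.extend f (α := α) (β := β) ?_ ?_ ?_ (fun j hj => move _ (h.s_mul_a j hj))
      (fun j hj => move _ (h.s_mul_b j hj)) (fun j hj => moveβ (h.s_mul_a j hj) (hpa j hj))
      (fun j hj => moveβ (h.s_mul_b j hj) (hpb j hj)) ?_ ?_ ?_ ?_
      (fun j hj => move _ (h.s_mul_a j hj)) (fun j hj => move _ (h.s_mul_b j hj)), ?_⟩
  · rw [hα, Algebra.TensorProduct.tmul_mul_tmul, extMulA_sq, TensorProduct.tmul_zero]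
  · rw [hβ]
    simp only [add_mul, mul_add, smul_mul_assoc, mul_smul_comm,
      Algebra.TensorProduct.tmul_mul_tmul, extMulB_sq, extDerA_sq, TensorProduct.tmul_zero,
      extDerA_mul_extMulB, hsp, hps, TensorProduct.tmul_neg]
    simp
  · rw [hα, hβ, hf]
    simp only [add_mul, mul_add, smul_mul_assoc, mul_smul_comm,
      Algebra.TensorProduct.tmul_mul_tmul, extMulB_mul_extMulA,
      extDerA_mul_extMulA, hsp, hps, TensorProduct.tmul_neg, TensorProduct.tmul_sub, smul_sub]
    abel
  · rw [Algebra.TensorProduct.tmul_mul_tmul, hst, extScale_mul_inv hq' hqi]; rfl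
  · have := extScale_mul_inv (inv_ne_zero hq') (inv_ne_zero hqi)
    rw [inv_inv, inv_inv] at this
    rw [Algebra.TensorProduct.tmul_mul_tmul, hts, this]; rfl
  · rw [hα, hs', Algebra.TensorProduct.tmul_mul_tmul, Algebra.TensorProduct.tmul_mul_tmul,
      extScale_mul_extMulA, TensorProduct.tmul_smul]
  · rw [hβ, hs', mul_add, add_mul, mul_smul_comm, smul_mul_assoc]
    simp only [Algebra.TensorProduct.tmul_mul_tmul, extScale_mul_extMulB,
      extScale_mul_extDerA hq', TensorProduct.tmul_smul, hsp, hps, smul_add, inv_neg]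
    rw [smul_comm c]
  · have ea : ∀ i < n, (if i < n then f (a i) else α) = f (a i) := fun i hi => if_pos hi
    have eb : ∀ i < n, (if i < n then f (b i) else β) = f (b i) := fun i hi => if_pos hi
    rw [initProd, revProd, initProd_congr ea, revProd_congr eb, map_initProd, map_revProd,
      if_neg (lt_irrefl n), if_neg (lt_irrefl n)]
    set L := initProd a n
    set R' := revProd b n with hR
    intro h0
    -- Entry `(3, 0)` is the coefficient of `αβ` in the image of `1`; it is `1` for `extMulA *
    -- extMulB` and `0` for the derivation term, since `∂1 = 0`.
    let ev : M →ₗ[ℂ] ℂ := Matrix.entryLinearMap ℂ ℂ (3 : Fin 4) (0 : Fin 4)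
    let g : B ⊗[ℂ] M →ₗ[ℂ] B := (TensorProduct.rid ℂ B).toLinearMap ∘ₗ ev.lTensor B
    have hg : ∀ x m, g (x ⊗ₜ[ℂ] m) = m 3 0 • x := fun x m => by
      simp only [g, ev, LinearMap.comp_apply, LinearMap.lTensor_tmul]
      exact TensorProduct.rid_tmul _ _
    have e1 : f L * α * (β * f R') =
        (L * s * (s * R')) ⊗ₜ[ℂ] (extMulA * extMulB) +
          c • ((L * s * (p * R')) ⊗ₜ[ℂ] (extMulA * extDerA)) := by
      rw [hα, hβ, hf, hf]
      simp only [add_mul, mul_add, smul_mul_assoc, mul_smul_comm,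
        Algebra.TensorProduct.tmul_mul_tmul, one_mul, mul_one]
    have m1 : (extMulA * extMulB) 3 0 = 1 := by
      simp [extMulA, extMulB, Matrix.mul_apply, Fin.sum_univ_four]
    have m2 : (extMulA * extDerA) 3 0 = 0 := by
      simp [extMulA, extDerA, Matrix.mul_apply, Fin.sum_univ_four]
    have h1 : L * s * (s * R') = 0 := by
      have := congrArg g h0
      rwa [e1, map_add, map_smul, hg, hg, m1, m2, one_smul, zero_smul, smul_zero, add_zero,
        map_zero] at this
    have hsR : s * R' = (-q⁻¹) ^ n • (R' * s) := mul_revProd h.s_mul_b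
    have hd : (-q⁻¹) ^ n ≠ 0 := pow_ne_zero _ hqi
    rw [hsR, mul_smul_comm, smul_eq_zero_iff_right hd, mul_assoc, ← mul_assoc s, hsR,
      smul_mul_assoc, mul_smul_comm, smul_eq_zero_iff_right hd] at h1
    apply hne
    calc L * R' = L * (R' * s * s) * t * t := by
          simp only [mul_assoc]
          rw [← mul_assoc s t t, hst, one_mul, hst, mul_one]
      _ = 0 := by rw [h1, zero_mul, zero_mul]

/-- The induction starts from `ℂ` with no pairs and `s = t = 1`. -/
theorem exists_isTwistedPairSystem {q : ℂ} (hq : q ≠ 0) (n : ℕ) :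
    ∃ (B : Type) (_ : Ring B) (_ : Algebra ℂ B) (a b : ℕ → B) (s t : B),
      IsTwistedPairSystem q n a b s t ∧ initProd a n * revProd b n ≠ 0 := by
  induction n with
  | zero =>
    refine ⟨ℂ, inferInstance, inferInstance, 0, 0, 1, 1, ⟨⟨?_, ?_, ?_, ?_, ?_, ?_, ?_⟩,
      one_mul 1, one_mul 1, ?_, ?_⟩, by simp [initProd, revProd]⟩
    all_goals intros; omega
  | succ n ih =>
    obtain ⟨B, _, _, a, b, s, t, h, hne⟩ := ih
    exact h.exists_extend hq hne

end Realization

/-! ### Powers of `q` with exponent `ρ`, and the matrix `D`. -/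

section Rho

variable {N : ℕ}

lemma rho_of_lt {i : Fin N} (h : 2 * (i : ℕ) + 1 < N) : rho i = (N : ℝ) / 2 - 1 - (i : ℕ) := by
  simp [rho, h]

lemma rho_of_eq {i : Fin N} (h : 2 * (i : ℕ) + 1 = N) : rho i = 0 := by
  simp [rho, h]

lemma rho_rev (i : Fin N) : rho i.rev = -rho i := by
  have hi := i.isLt
  have hc : ((N - (i + 1) : ℕ) : ℝ) = N - (i + 1) := by
    rw [Nat.cast_sub (by omega)]; push_cast; ring
  unfold rho
  rw [Fin.val_rev, hc]
  split_ifs <;> first | omega | ring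

/-- The complex number `q ^ ρ_i`. -/
def rhoPow (q : ℝ) (i : Fin N) : ℂ := ((q ^ rho i : ℝ) : ℂ)

lemma rhoPow_ne_zero {q : ℝ} (hq : 0 < q) (i : Fin N) : rhoPow q i ≠ 0 := by
  rw [rhoPow, Ne, Complex.ofReal_eq_zero]
  exact (Real.rpow_pos_of_pos hq _).ne'

lemma rhoPow_rev {q : ℝ} (hq : 0 < q) (i : Fin N) : rhoPow q i.rev = (rhoPow q i)⁻¹ := by
  rw [rhoPow, rhoPow, rho_rev, Real.rpow_neg hq.le, Complex.ofReal_inv]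

lemma rhoPow_of_eq (q : ℝ) {i : Fin N} (h : 2 * (i : ℕ) + 1 = N) : rhoPow q i = 1 := by
  simp [rhoPow, rho_of_eq h]

lemma rhoPow_sq {q : ℝ} (hq : 0 < q) {i : Fin N} (h : 2 * (i : ℕ) + 1 < N) :
    rhoPow q i ^ 2 = (q : ℂ) ^ (N - 2 - 2 * (i : ℕ)) := by
  rw [rhoPow, ← Complex.ofReal_pow, ← Complex.ofReal_pow, ← Real.rpow_natCast,
    ← Real.rpow_mul hq.le, ← Real.rpow_natCast, rho_of_lt h]
  congr 2
  rw [Nat.sub_sub, Nat.cast_sub (by omega)]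
  push_cast
  ring

/-- The constant `q ^ (N / 2 - 1)`, the largest of the `q ^ ρ_i`. -/
def topPow (N : ℕ) (q : ℝ) : ℂ := ((q ^ ((N : ℝ) / 2 - 1) : ℝ) : ℂ)

lemma topPow_ne_zero (N : ℕ) {q : ℝ} (hq : 0 < q) : topPow N q ≠ 0 := by
  rw [topPow, Ne, Complex.ofReal_eq_zero]
  exact (Real.rpow_pos_of_pos hq _).ne'

lemma rhoPow_eq_topPow {q : ℝ} (hq : 0 < q) {i : Fin N} (h : 2 * (i : ℕ) + 1 < N) :
    rhoPow q i = topPow N q * ((q : ℂ) ^ (i : ℕ))⁻¹ := by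
  rw [rhoPow, topPow, rho_of_lt h, Real.rpow_sub hq, Real.rpow_natCast]
  push_cast
  rw [div_eq_mul_inv]

/-- The metric is its own inverse because `ρ_{i'} = -ρ_i`, so `D` is diagonal with entries `q ^
(-2ρ_i)`. -/
lemma D_apply {q : ℝ} (hq : 0 < q) (i l : Fin N) :
    (D N q i l : ℂ) = if i = l then (rhoPow q i ^ 2)⁻¹ else 0 := by
  have hup : gUp N q = gLow N q := by
    refine Matrix.inv_eq_right_inv ?_
    ext i k
    rw [Matrix.mul_apply, Finset.sum_eq_single i.rev]
    · simp only [gLow, Matrix.of_apply, if_true, Fin.rev_rev, Matrix.one_apply, mul_ite, mul_zero,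
        rho_rev, eq_comm (a := k)]
      rw [← Real.rpow_add hq]
      simp
    · intro b _ hb
      simp [gLow, hb]
    · simp
  have : D N q i l = if i = l then (q ^ rho i)⁻¹ ^ 2 else 0 := by
    rw [D, Matrix.of_apply, hup, Finset.sum_eq_single i.rev]
    · simp only [gLow, Matrix.of_apply, if_true, Fin.rev_inj, mul_ite, mul_zero]
      split_ifs with h
      · rw [h, sq, Real.rpow_neg hq.le]
      · rfl
    · intro b _ hb
      simp [gLow, hb]
    · simp
  rw [this, rhoPow]
  split_ifs <;> simp

end Rho

/-! ### Explicit evaluation of the `R`-matrix relations. -/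

section Relations

variable {N : ℕ} {A : Type*} [Ring A] [Algebra ℂ A]

/-- The partial sum `∑_{k < m} q ^ (-ρ_k) x_k x_{k'}`. -/
def metricSum (q : ℝ) (X : Fin N → A) (m : ℕ) : A :=
  ∑ k ∈ Finset.univ.filter (fun k : Fin N => (k : ℕ) < m), (rhoPow q k)⁻¹ • (X k * X k.rev)

lemma metricSum_zero (q : ℝ) (X : Fin N → A) : metricSum q X 0 = 0 := by
  simp [metricSum]

lemma metricSum_succ (q : ℝ) (X : Fin N → A) (i : Fin N) :
    metricSum q X ((i : ℕ) + 1) = metricSum q X i + (rhoPow q i)⁻¹ • (X i * X i.rev) := by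
  have : Finset.univ.filter (fun k : Fin N => (k : ℕ) < (i : ℕ) + 1) =
      insert i (Finset.univ.filter fun k : Fin N => (k : ℕ) < (i : ℕ)) := by
    ext k
    simp only [Finset.mem_filter, Finset.mem_univ, true_and, Finset.mem_insert, Fin.ext_iff]
    omega
  rw [metricSum, this, Finset.sum_insert (by simp), add_comm, metricSum]

lemma ofReal_ite_and {P Q : Prop} [Decidable P] [Decidable Q] (c : ℝ) :
    ((if P ∧ Q then c else 0 : ℝ) : ℂ) = if Q then (if P then (c : ℂ) else 0) else 0 := by
  split_ifs <;> simp_all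

lemma ofReal_ite_and_and {P Q S : Prop} [Decidable P] [Decidable Q] [Decidable S] (c : ℝ) :
    ((if P ∧ Q ∧ S then c else 0 : ℝ) : ℂ) =
      if Q then (if P then (if S then (c : ℂ) else 0) else 0) else 0 := by
  split_ifs <;> simp_all

/-- The right-hand side of the commutation relations, evaluated. -/
lemma sum_Rhat_smul {q : ℝ} (hq : 0 < q) (X : Fin N → A) (i j : Fin N) :
    ∑ k, ∑ l, ((-(q * Rhat q i j k l) : ℝ) : ℂ) • (X k * X l) =
      (-(q : ℂ) * (if j = i then (if j = j.rev then 1 else (q : ℂ))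
        else (if j = i.rev then (q : ℂ)⁻¹ else 1))) • (X j * X i)
      + (if i < j then (1 - (q : ℂ) ^ 2) • (X i * X j) else 0)
      + (if i = j.rev then (((q : ℂ) ^ 2 - 1) * rhoPow q j) • metricSum q X j else 0) := by
  have hq0 : (q : ℂ) ≠ 0 := Complex.ofReal_ne_zero.2 hq.ne'
  set d : ℂ := (if j = i then (if j = j.rev then 1 else (q : ℂ))
        else (if j = i.rev then (q : ℂ)⁻¹ else 1)) with hd
  have hR : ∀ k l, ((-(q * Rhat q i j k l) : ℝ) : ℂ) • (X k * X l) =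
      (if l = i then (if k = j then (-(q : ℂ) * d) • (X k * X l) else 0) else 0)
      + (if l = j then (if k = i then (if i < j then (1 - (q : ℂ) ^ 2) • (X k * X l) else 0) else 0)
          else 0)
      + (if l = k.rev then (if (k : ℕ) < j then (if i = j.rev then
          (((q : ℂ) ^ 2 - 1) * rhoPow q j) • ((rhoPow q k)⁻¹ • (X k * X l)) else 0) else 0)
          else 0) := by
    intro k l
    have e : ((-(q * Rhat q i j k l) : ℝ) : ℂ) =
        (if l = i then (if k = j then -(q : ℂ) * d else 0) else 0)
      + (if l = j then (if k = i then (if i < j then (1 - (q : ℂ) ^ 2) else 0) else 0)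
          else 0)
      + (if l = k.rev then (if (k : ℕ) < j then (if i = j.rev then
          (((q : ℂ) ^ 2 - 1) * rhoPow q j) * (rhoPow q k)⁻¹ else 0) else 0) else 0) := by
      have e1 : ((if k = j ∧ l = i then
          (if j = i then (if j = j.rev then 1 else q) else (if j = i.rev then q⁻¹ else 1))
          else 0 : ℝ) : ℂ) = if l = i then (if k = j then d else 0) else 0 := by
        rw [ofReal_ite_and, hd]
        simp only [apply_ite Complex.ofReal, Complex.ofReal_one,
          Complex.ofReal_inv]
      have e2 : ((if k = i ∧ l = j ∧ i < j then q - q⁻¹ else 0 : ℝ) : ℂ) =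
          if l = j then (if k = i then (if i < j then (q : ℂ) - (q : ℂ)⁻¹ else 0) else 0)
            else 0 := by
        rw [ofReal_ite_and_and, Complex.ofReal_sub, Complex.ofReal_inv]
      have e3 : ((if i = j.rev ∧ l = k.rev ∧ k < j then
          (q - q⁻¹) * q ^ (rho j - rho k) else 0 : ℝ) : ℂ) =
          if l = k.rev then (if (k : ℕ) < j then (if i = j.rev then
            ((q : ℂ) - (q : ℂ)⁻¹) * (rhoPow q j * (rhoPow q k)⁻¹) else 0) else 0) else 0 := by
        rw [Real.rpow_sub hq, rhoPow, rhoPow, div_eq_mul_inv, ofReal_ite_and_and]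
        simp only [Complex.ofReal_sub, Complex.ofReal_inv, Complex.ofReal_mul, Fin.lt_def]
        split_ifs <;> rfl
      have f2 : -(q : ℂ) * ((q : ℂ) - (q : ℂ)⁻¹) = 1 - (q : ℂ) ^ 2 := by field_simp; ring
      have f3 : ∀ x y : ℂ, -(q : ℂ) * (((q : ℂ) - (q : ℂ)⁻¹) * (x * y)) =
          -(((q : ℂ) ^ 2 - 1) * x * y) := by intro x y; field_simp
      rw [Complex.ofReal_neg, Complex.ofReal_mul, Rhat, R, Complex.ofReal_sub, Complex.ofReal_add,
        e1, e2, e3, ← neg_mul, mul_sub, mul_add, sub_eq_add_neg]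
      simp only [mul_ite, mul_zero, f2, f3]
      congr 1
      split_ifs <;> simp
    rw [e, add_smul, add_smul]
    simp only [ite_smul, zero_smul, smul_smul]
  simp only [hR, Finset.sum_add_distrib, Finset.sum_ite_eq', Finset.mem_univ,
    if_true]
  congr 1
  rw [metricSum, Finset.sum_filter]
  split_ifs with h
  · rw [Finset.smul_sum]
    refine Finset.sum_congr rfl fun k _ => ?_
    split_ifs <;> simp
  · simp

end Relations

/-! ### Reordering the generators by conjugate pairs. -/

section PairSeq

variable {N : ℕ} {A : Type*} [Ring A]

/-- The generators in the order `1, 1', 2, 2', …`. -/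
def pairIndex (k : Fin N) : Fin N :=
  if Even (k : ℕ) then ⟨k / 2, by omega⟩ else (⟨k / 2, by omega⟩ : Fin N).rev

lemma val_pairIndex_even {k : Fin N} (hk : (k : ℕ) % 2 = 0) :
    (pairIndex k : ℕ) = k / 2 := by
  rw [pairIndex, if_pos (Nat.even_iff.2 hk)]

lemma val_pairIndex_odd {k : Fin N} (hk : (k : ℕ) % 2 = 1) :
    (pairIndex k : ℕ) = N - (k / 2 + 1) := by
  rw [pairIndex, if_neg (by rw [Nat.even_iff]; omega), Fin.val_rev]

lemma pairIndex_surjective : Function.Surjective (pairIndex (N := N)) := by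
  intro i
  rcases Nat.lt_or_ge N (2 * (i : ℕ) + 1) with hi | hi
  · refine ⟨⟨2 * (N - 1 - i) + 1, by omega⟩, Fin.ext ?_⟩
    rw [val_pairIndex_odd (by simp)]
    simp only
    omega
  · refine ⟨⟨2 * i, by omega⟩, Fin.ext ?_⟩
    rw [val_pairIndex_even (by simp)]
    simp only
    omega

/-- A family of generators rearranged into the sequence `x_1, x_{1'}, x_2, x_{2'}, …`. -/
def pairSeq (X : Fin N → A) (k : ℕ) : A := if h : k < N then X (pairIndex ⟨k, h⟩) else 0

lemma pairSeq_of_lt (X : Fin N → A) {k : ℕ} (h : k < N) :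
    pairSeq X k = X (pairIndex ⟨k, h⟩) := dif_pos h

lemma pairSeq_two_mul (X : Fin N → A) (m : Fin N) (h : 2 * (m : ℕ) < N) :
    pairSeq X (2 * (m : ℕ)) = X m := by
  rw [pairSeq_of_lt X h]
  congr 1
  ext
  rw [val_pairIndex_even (by simp)]
  simp

lemma pairSeq_two_mul_add_one (X : Fin N → A) (m : Fin N) (h : 2 * (m : ℕ) + 1 < N) :
    pairSeq X (2 * (m : ℕ) + 1) = X m.rev := by
  rw [pairSeq_of_lt X h]
  congr 1
  ext
  rw [val_pairIndex_odd (by simp), Fin.val_rev]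
  simp only
  omega

end PairSeq

/-! ### The solved relations: equivalence with the original ones, and the tower property. -/

section Exterior

variable {N : ℕ} {A : Type*} [Ring A] [Algebra ℂ A]

/-- The commutation relations of the differentials, solved for ordered products. -/
structure IsExterior (q : ℝ) (X : Fin N → A) : Prop where
  sq : ∀ i : Fin N, i ≠ i.rev → X i * X i = 0
  comm : ∀ i j : Fin N, i < j → j ≠ i.rev → X j * X i = (-(q : ℂ)) • (X i * X j)
  hyp : ∀ i : Fin N, 2 * (i : ℕ) + 1 < N → X i.rev * X i + X i * X i.rev =
    (((q : ℂ) ^ 2 - 1) * rhoPow q i) • metricSum q X i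
  mid : ∀ i : Fin N, 2 * (i : ℕ) + 1 = N → X i * X i = ((q : ℂ) - 1) • metricSum q X i

lemma rev_eq_self_iff (i : Fin N) : i = i.rev ↔ 2 * (i : ℕ) + 1 = N := by
  rw [Fin.ext_iff, Fin.val_rev]
  omega

lemma lt_rev_self_iff (i : Fin N) : i < i.rev ↔ 2 * (i : ℕ) + 1 < N := by
  rw [Fin.lt_def, Fin.val_rev]
  omega

lemma one_add_ofReal_ne_zero {q : ℝ} (hq : 0 < q) : 1 + (q : ℂ) ≠ 0 := by
  have : (1 + q : ℝ) ≠ 0 := by positivity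
  exact_mod_cast this

/-- The commutation relations imply their solved form. -/
theorem isExterior_of_relations {q : ℝ} (hq : 0 < q) {X : Fin N → A}
    (h : ∀ i j, X i * X j = ∑ k, ∑ l, ((-(q * Rhat q i j k l) : ℝ) : ℂ) • (X k * X l)) :
    IsExterior q X := by
  have hq0 : (q : ℂ) ≠ 0 := Complex.ofReal_ne_zero.2 hq.ne'
  simp only [sum_Rhat_smul hq X] at h
  refine ⟨fun i hi => ?_, fun i j hij hj => ?_, fun i hi => ?_, fun i hi => ?_⟩
  · have e := h i i
    rw [if_pos rfl, if_neg hi, if_neg (lt_irrefl i), if_neg hi, add_zero, add_zero] at e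
    -- The diagonal relation reads `x² = -q² x²`; positivity of `q` makes `1 + q²` invertible.
    have h2 : (1 + (q : ℂ) * q) • (X i * X i) = 0 := by
      rw [add_smul, one_smul]
      nth_rw 1 [e]
      rw [← add_smul, neg_mul, neg_add_cancel, zero_smul]
    have hne : (1 + (q : ℂ) * q) ≠ 0 := by
      have := one_add_ofReal_ne_zero (mul_pos hq hq)
      rwa [Complex.ofReal_mul] at this
    exact (smul_eq_zero_iff_right hne).1 h2
  · have hij' : i ≠ j.rev := fun e => hj (by rw [e, Fin.rev_rev])
    have e := h j i
    rwa [if_neg hij.ne, if_neg hij', if_neg hij.not_gt, if_neg hj, add_zero, add_zero,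
      mul_one] at e
  · have hlt := (lt_rev_self_iff i).2 hi
    have e := h i.rev i
    rw [Fin.rev_rev, if_neg hlt.ne, if_pos rfl, if_neg hlt.not_gt, if_pos rfl, add_zero, neg_mul,
      mul_inv_cancel₀ hq0, neg_one_smul] at e
    rw [e]
    abel
  · have hr := (rev_eq_self_iff i).2 hi
    have e := h i i
    rw [if_pos rfl, if_pos hr, if_neg (lt_irrefl i), if_pos hr, add_zero, mul_one,
      rhoPow_of_eq q hi, mul_one] at e
    have h2 : (1 + (q : ℂ)) • (X i * X i) = (1 + (q : ℂ)) • (((q : ℂ) - 1) • metricSum q X i) := by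
      rw [add_smul, one_smul]
      nth_rw 1 [e]
      rw [neg_smul, neg_add_eq_sub, sub_add_cancel, smul_smul]
      congr 1
      ring
    exact smul_right_injective _ (one_add_ofReal_ne_zero hq) h2

namespace IsExterior

variable {q : ℝ} {X : Fin N → A} (h : IsExterior q X)
include h

/-- The partial metric sums beyond the middle are multiples of those before the middle. -/
lemma metricSum_rev (hq : 0 < q) (i : Fin N) (hi : 2 * (i : ℕ) + 1 < N) :
    metricSum q X (i.rev : Fin N) = rhoPow q i ^ 2 • metricSum q X ((i : ℕ) + 1) := by
  -- Induction outwards from the middle; `d` counts the pairs strictly inside the pair of `i`.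
  obtain ⟨d, hd⟩ : ∃ d, d = (N - 2 - 2 * (i : ℕ)) / 2 := ⟨_, rfl⟩
  have hrho := rhoPow_sq hq hi
  induction d generalizing i with
  | zero =>
    rcases Nat.lt_or_ge (2 * (i : ℕ) + 2) N with h2 | h2
    · let m : Fin N := ⟨i + 1, by omega⟩
      have hm : 2 * (m : ℕ) + 1 = N := by change 2 * ((i : ℕ) + 1) + 1 = N; omega
      have hr : (i.rev : ℕ) = (m : ℕ) + 1 := by
        change _ = (i : ℕ) + 1 + 1; rw [Fin.val_rev]; omega
      have hmr := (rev_eq_self_iff m).2 hm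
      rw [hr, metricSum_succ, ← hmr, h.mid m hm, rhoPow_of_eq q hm, hrho,
        show N - 2 - 2 * (i : ℕ) = 1 by omega, pow_one, inv_one, one_smul]
      change metricSum q X ((i : ℕ) + 1) + _ = _
      rw [sub_smul, one_smul]
      exact add_sub_cancel _ _
    · rw [hrho, show N - 2 - 2 * (i : ℕ) = 0 by omega, pow_zero, one_smul]
      congr 1
      rw [Fin.val_rev]; omega
  | succ d ih =>
    let m : Fin N := ⟨i + 1, by omega⟩
    have hmv : (m : ℕ) = i + 1 := rfl
    have hm : 2 * (m : ℕ) + 1 < N := by omega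
    have hr : (i.rev : ℕ) = (m.rev : ℕ) + 1 := by rw [Fin.val_rev, Fin.val_rev]; omega
    have hhyp : X m.rev * X m = (((q : ℂ) ^ 2 - 1) * rhoPow q m) • metricSum q X m
        - X m * X m.rev := eq_sub_of_add_eq (h.hyp m hm)
    have hp := rhoPow_ne_zero hq m
    have hpow : rhoPow q i ^ 2 = (q : ℂ) ^ 2 * rhoPow q m ^ 2 := by
      rw [hrho, rhoPow_sq hq hm, ← pow_add]
      congr 1
      omega
    rw [hr, metricSum_succ, ih m hm (by omega) (rhoPow_sq hq hm), metricSum_succ, Fin.rev_rev,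
      hhyp, rhoPow_rev hq, inv_inv, hpow, ← hmv, smul_add, smul_sub, smul_smul, smul_smul,
      show rhoPow q m ^ 2 * (rhoPow q m)⁻¹ = rhoPow q m by field_simp]
    rw [add_assoc, add_sub_cancel, ← add_smul]
    congr 1
    ring

/-- The solved form of the commutation relations implies all commutation relations. -/
theorem relations (hq : 0 < q) (i j : Fin N) :
    X i * X j = ∑ k, ∑ l, ((-(q * Rhat q i j k l) : ℝ) : ℂ) • (X k * X l) := by
  have hq0 : (q : ℂ) ≠ 0 := Complex.ofReal_ne_zero.2 hq.ne'
  rw [sum_Rhat_smul hq X]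
  by_cases hr : i = j.rev
  · subst hr
    rw [if_pos rfl]
    rcases lt_trichotomy (2 * (j : ℕ) + 1) N with hj | hj | hj
    · have hlt := (lt_rev_self_iff j).2 hj
      rw [if_neg hlt.ne, Fin.rev_rev, if_pos rfl, if_neg hlt.not_gt, add_zero, neg_mul,
        mul_inv_cancel₀ hq0, neg_one_smul, ← h.hyp j hj]
      abel
    · have he := (rev_eq_self_iff j).2 hj
      rw [if_pos he, if_pos he, ← he, if_neg (lt_irrefl j), h.mid j hj, rhoPow_of_eq q hj, add_zero,
        mul_one, mul_one, smul_smul, ← add_smul]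
      congr 1
      ring
    -- This relation involves a metric sum past the middle. `metricSum_rev` folds it back, and the
    -- relation becomes a consequence of `hyp`.
    · obtain ⟨i, rfl⟩ : ∃ i : Fin N, j = i.rev := ⟨j.rev, (Fin.rev_rev j).symm⟩
      have hi : 2 * (i : ℕ) + 1 < N := by rw [Fin.val_rev] at hj; omega
      have hlt := (lt_rev_self_iff i).2 hi
      have hp := rhoPow_ne_zero hq i
      have hh : X i.rev * X i = (((q : ℂ) ^ 2 - 1) * rhoPow q i) • metricSum q X i
        - X i * X i.rev := eq_sub_of_add_eq (h.hyp i hi)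
      rw [Fin.rev_rev, if_neg hlt.ne', if_pos rfl, if_pos hlt, h.metricSum_rev hq i hi,
        metricSum_succ, hh, rhoPow_rev hq, neg_mul, mul_inv_cancel₀ hq0, neg_one_smul, smul_add,
        smul_add, smul_smul, smul_smul, smul_smul,
        show ((q : ℂ) ^ 2 - 1) * (rhoPow q i)⁻¹ * rhoPow q i ^ 2
          = ((q : ℂ) ^ 2 - 1) * rhoPow q i by field_simp,
        show ((q : ℂ) ^ 2 - 1) * rhoPow q i * (rhoPow q i)⁻¹
          = -(1 - (q : ℂ) ^ 2) by field_simp; ring, neg_smul]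
      abel
  · have hr' : j ≠ i.rev := fun e => hr (by rw [e, Fin.rev_rev])
    rw [if_neg hr, add_zero]
    rcases lt_trichotomy i j with hij | rfl | hij
    · rw [if_neg hij.ne', if_neg hr', if_pos hij, h.comm i j hij hr', smul_smul, ← add_smul]
      nth_rw 1 [← one_smul ℂ (X i * X j)]
      congr 1
      ring
    · rw [if_pos rfl, if_neg hr, if_neg (lt_irrefl i), h.sq i hr, smul_zero, add_zero]
    · rw [if_neg hij.ne, if_neg hr', if_neg hij.not_gt, add_zero, mul_one, h.comm j i hij hr]

end IsExterior

lemma mem_initSpan_pairSeq (X : Fin N → A) (i : Fin N) : X i ∈ initSpan (pairSeq X) N := by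
  obtain ⟨k, rfl⟩ := pairIndex_surjective i
  rw [← pairSeq_of_lt X k.isLt]
  exact mem_initSpan _ k.isLt

lemma metricSum_mem (q : ℝ) (X : Fin N → A) {m : ℕ} (hm : 2 * m ≤ N) :
    metricSum q X m ∈ initSpan (pairSeq X) (2 * m) ^ 2 := by
  refine Submodule.sum_mem _ fun k hk => Submodule.smul_mem _ _ ?_
  have hk : (k : ℕ) < m := (Finset.mem_filter.1 hk).2
  rw [sq, ← pairSeq_two_mul X k (by omega), ← pairSeq_two_mul_add_one X k (by omega)]
  exact Submodule.mul_mem_mul (mem_initSpan _ (by omega)) (mem_initSpan _ (by omega))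

/-- Every generator after the pair `m, m'` has index strictly between `m` and `m'`. It therefore
picks up `-q` in passing `x_m` and `-q⁻¹` in passing `x_{m'}`. -/
theorem IsExterior.isTower {q : ℝ} (hq : 0 < q) {X : Fin N → A} (h : IsExterior q X) :
    IsTower (q : ℂ) N (pairSeq X) := by
  have hq0 : (q : ℂ) ≠ 0 := Complex.ofReal_ne_zero.2 hq.ne'
  refine ⟨fun i j hij hj hp => ?_, fun i he hi => ?_, fun i hi he => ?_, fun i hi ho => ?_⟩
  · rw [pairSeq_of_lt X hj, pairSeq_of_lt X (hij.trans hj), exchange]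
    set I : Fin N := ⟨i, hij.trans hj⟩ with hI
    set J : Fin N := ⟨j, hj⟩ with hJ
    have vI : (I : ℕ) = i := rfl
    have vJ : (J : ℕ) = j := rfl
    have hJv : (pairIndex J : ℕ) = j / 2 ∨ (pairIndex J : ℕ) = N - (j / 2 + 1) := by
      rcases Nat.mod_two_eq_zero_or_one j with e | e
      · exact Or.inl (val_pairIndex_even e)
      · exact Or.inr (val_pairIndex_odd e)
    split_ifs with he
    · have hIv := val_pairIndex_even (k := I) (Nat.even_iff.1 he)
      have he2 := Nat.even_iff.1 he
      have hp' : j ≠ i + 1 := fun e => hp ⟨he, e⟩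
      refine h.comm _ _ ?_ ?_
      · rw [Fin.lt_def]; omega
      · rw [Ne, Fin.ext_iff, Fin.val_rev]; omega
    · have he2 : i % 2 = 1 := by rw [Nat.even_iff] at he; omega
      have hIv := val_pairIndex_odd (k := I) he2
      have hc := h.comm (pairIndex J) (pairIndex I) (by rw [Fin.lt_def]; omega)
        (by rw [Ne, Fin.ext_iff, Fin.val_rev]; omega)
      rw [hc, smul_smul, neg_mul_neg, inv_mul_cancel₀ hq0, one_smul]
  · obtain ⟨m, rfl⟩ := he.two_dvd
    have e0 := pairSeq_two_mul X ⟨m, by omega⟩ (by simp only; omega)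
    have e1 := pairSeq_two_mul_add_one X ⟨m, by omega⟩ (by simpa using hi)
    simp only at e0 e1
    rw [e0, e1, h.hyp _ (by simpa using hi)]
    exact Submodule.smul_mem _ _ (metricSum_mem q X (by omega))
  · obtain ⟨m, rfl⟩ := he.two_dvd
    have e0 := pairSeq_two_mul X ⟨m, by omega⟩ hi
    simp only at e0
    rw [e0]
    by_cases hm : 2 * m + 1 = N
    · rw [h.mid _ hm]
      exact Submodule.smul_mem _ _ (metricSum_mem q X (by omega))
    · rw [h.sq _ (by rw [Ne, rev_eq_self_iff]; exact hm)]
      exact zero_mem _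
  · obtain ⟨m, rfl⟩ := Nat.not_even_iff_odd.1 ho
    have e1 := pairSeq_two_mul_add_one X ⟨m, by omega⟩ hi
    simp only at e1
    rw [e1]
    refine h.sq _ ?_
    rw [Fin.rev_rev, ne_comm, Ne, rev_eq_self_iff]
    simp only
    omega

/-- The factor in the cyclic property is the matrix entry of `D` up to sign. -/
lemma cyclicFactor_eq {q : ℝ} (hq : 0 < q) (k : Fin N) :
    cyclicFactor (q : ℂ) N k = (-1) ^ (N - 1) * (rhoPow q (pairIndex k) ^ 2)⁻¹ := by
  have hk := k.isLt
  unfold cyclicFactor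
  rcases Nat.mod_two_eq_zero_or_one k with e | e
  · have hv := val_pairIndex_even e
    rw [if_pos (Nat.even_iff.2 e)]
    split_ifs with hN
    · rw [rhoPow_of_eq q (by omega), Even.neg_one_pow (Nat.even_iff.2 (by omega))]
      simp
    · rw [rhoPow_sq hq (by omega), hv, show N - 2 - 2 * ((k : ℕ) / 2) = N - k - 2 by omega,
        show N - 1 = (N - k - 2) + 1 + 2 * (k / 2) by omega, neg_pow, pow_add, pow_add, pow_mul]
      simp
  · have hv := val_pairIndex_odd e
    let m : Fin N := ⟨k / 2, by omega⟩
    have hm : pairIndex k = m.rev := by ext; rw [hv, Fin.val_rev]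
    have hmv : (m : ℕ) = k / 2 := rfl
    rw [if_neg (by rw [Nat.even_iff]; omega), hm, rhoPow_rev hq, inv_pow, inv_inv,
      rhoPow_sq hq (by omega), hmv, show N - 2 - 2 * ((k : ℕ) / 2) = N - k - 1 by omega,
      show N - 1 = (N - k - 1) + 1 + 2 * (k / 2) by omega, neg_pow, pow_add, pow_add, pow_mul]
    simp

end Exterior

/-! ### Ordered products of lists. -/

section Products

lemma prod_ofFn_eq_initProd {A : Type*} [Ring A] {N : ℕ} (X : Fin N → A) (x : ℕ → A)
    (h : ∀ i : Fin N, X i = x i) : (List.ofFn X).prod = initProd x N := by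
  induction N with
  | zero => simp [initProd]
  | succ N ih =>
    rw [List.ofFn_succ', List.concat_eq_append, List.prod_append, List.prod_singleton,
      ih _ fun i => h i.castSucc, h, initProd, Fin.val_last]

lemma initProd_add {A : Type*} [Ring A] {x b : ℕ → A} (m k : ℕ)
    (h : ∀ i < k, x (m + (k - 1 - i)) = b i) :
    initProd x (m + k) = initProd x m * revProd b k := by
  induction k generalizing m with
  | zero => simp [revProd]
  | succ k ih =>
    have h0 : x m = b k := by simpa using h k (by omega)
    rw [show m + (k + 1) = m + 1 + k by ring, ih (m + 1), initProd, revProd, h0, mul_assoc]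
    intro i hi
    rw [← h i (by omega)]
    congr 1
    omega

lemma prod_ofFn_mem_pow {A : Type*} [Ring A] [Algebra ℂ A] {n : ℕ} {V : Submodule ℂ A}
    (X : Fin n → A) (h : ∀ i, X i ∈ V) : (List.ofFn X).prod ∈ V ^ n := by
  induction n with
  | zero => exact Submodule.one_le.1 (le_refl (1 : Submodule ℂ A))
  | succ n ih =>
    rw [List.ofFn_succ, List.prod_cons, pow_succ']
    exact Submodule.mul_mem_mul (h 0) (ih _ fun i => h i.succ)

end Products

/-! ### Realization of the forms inside a pair system. -/

section Realization

variable {B : Type*} [Ring B] [Algebra ℂ B]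

/-- The coefficient of the middle generator in terms of a hyperbolic pair. -/
def midCoeff (N : ℕ) (q : ℝ) : ℂ := (topPow N q)⁻¹ * (q : ℂ) ^ (N / 2) * (1 + (q : ℂ))⁻¹

/-- The generators of the exterior algebra of `N`-dimensional quantum Euclidean space inside the
algebra of a pair system. -/
def pairRealization (N : ℕ) (q : ℝ) (a b : ℕ → B) (i : ℕ) : B :=
  if 2 * i + 1 < N then a i
  else if 2 * i + 1 = N then a i + midCoeff N q • b i
  else b (N - 1 - i)

lemma pairRealization_of_lt {N : ℕ} (q : ℝ) (a b : ℕ → B) {i : ℕ} (h : 2 * i + 1 < N) :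
    pairRealization N q a b i = a i := if_pos h

lemma pairRealization_of_eq {N : ℕ} (q : ℝ) (a b : ℕ → B) {i : ℕ} (h : 2 * i + 1 = N) :
    pairRealization N q a b i = a i + midCoeff N q • b i := by
  rw [pairRealization, if_neg h.not_lt, if_pos h]

lemma pairRealization_of_gt {N : ℕ} (q : ℝ) (a b : ℕ → B) {i : ℕ} (h : N < 2 * i + 1) :
    pairRealization N q a b i = b (N - 1 - i) := by
  rw [pairRealization, if_neg h.not_gt, if_neg h.ne']

lemma metricSum_pairRealization {N : ℕ} {q : ℝ} (hq : 0 < q) (a b : ℕ → B) {m : ℕ}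
    (hm : 2 * m ≤ N) : metricSum q (fun i : Fin N => pairRealization N q a b i) m =
      (topPow N q)⁻¹ • pairSum (q : ℂ) a b m := by
  induction m with
  | zero => simp [metricSum_zero, pairSum]
  | succ m ih =>
    let i : Fin N := ⟨m, by omega⟩
    have hi : 2 * (i : ℕ) + 1 < N := by change 2 * m + 1 < N; omega
    have e := metricSum_succ q (fun i : Fin N => pairRealization N q a b i) i
    have hv : (i : ℕ) = m := rfl
    have hrev : pairRealization N q a b (i.rev : Fin N) = b m := by
      rw [pairRealization_of_gt q a b (by rw [Fin.val_rev]; omega), Fin.val_rev]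
      congr 1
      omega
    rw [hrev, pairRealization_of_lt q a b hi, rhoPow_eq_topPow hq hi, hv, ih (by omega)] at e
    rw [e, pairSum, smul_add, smul_smul, mul_inv, inv_inv]

lemma IsPairSystem.isExterior {N : ℕ} {q : ℝ} (hq : 0 < q) {a b : ℕ → B}
    (h : IsPairSystem (q : ℂ) (N / 2 + 1) a b) :
    IsExterior q (fun i : Fin N => pairRealization N q a b i) := by
  have hq0 : (q : ℂ) ≠ 0 := Complex.ofReal_ne_zero.2 hq.ne'
  have inv_comm : ∀ {x y : B}, x * y = (-(q : ℂ)⁻¹) • (y * x) → y * x = (-(q : ℂ)) • (x * y) := by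
    intro x y e
    rw [e, smul_smul, neg_mul_neg, mul_inv_cancel₀ hq0, one_smul]
  refine ⟨fun i hi => ?_, fun i j hij hj => ?_, fun i hi => ?_, fun i hi => ?_⟩
  · rw [Ne, rev_eq_self_iff] at hi
    rcases lt_or_gt_of_ne hi with hi | hi
    · simp only [pairRealization_of_lt q a b hi]
      exact h.a_sq _ (by omega)
    · simp only [pairRealization_of_gt q a b hi]
      exact h.b_sq _ (by omega)
  · have hij : (i : ℕ) < j := hij
    have hj : (j : ℕ) ≠ N - (i + 1) := fun e => hj (by ext; rw [e, Fin.val_rev])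
    have hjN := j.isLt
    rcases lt_trichotomy (2 * (i : ℕ) + 1) N with hi | hi | hi
    · simp only [pairRealization_of_lt q a b hi]
      rcases lt_trichotomy (2 * (j : ℕ) + 1) N with hj' | hj' | hj'
      · simp only [pairRealization_of_lt q a b hj']
        exact h.aa _ _ hij (by omega)
      · simp only [pairRealization_of_eq q a b hj']
        rw [add_mul, mul_add, smul_mul_assoc, h.aa _ _ hij (by omega), h.ba _ _ hij (by omega),
          mul_smul_comm, smul_add, smul_comm (midCoeff N q)]
      · simp only [pairRealization_of_gt q a b hj']
        rcases lt_or_gt_of_ne (show (i : ℕ) ≠ N - 1 - j by omega) with hl | hl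
        · exact h.ba _ _ hl (by omega)
        · exact inv_comm (h.ab _ _ hl (by omega))
    · have hj' : N < 2 * (j : ℕ) + 1 := by omega
      simp only [pairRealization_of_eq q a b hi, pairRealization_of_gt q a b hj']
      have hl : N - 1 - (j : ℕ) < i := by omega
      apply inv_comm
      rw [add_mul, mul_add, smul_mul_assoc, h.ab _ _ hl (by omega), h.bb _ _ hl (by omega),
        mul_smul_comm, smul_add, smul_comm (midCoeff N q)]
    · have hj' : N < 2 * (j : ℕ) + 1 := by omega
      simp only [pairRealization_of_gt q a b hi, pairRealization_of_gt q a b hj']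
      exact inv_comm (h.bb _ _ (by omega) (by omega))
  · have hv : N - 1 - (i.rev : ℕ) = i := by rw [Fin.val_rev]; omega
    have ht := topPow_ne_zero N hq
    rw [metricSum_pairRealization hq a b (by omega), pairRealization_of_lt q a b hi,
      pairRealization_of_gt q a b (by rw [Fin.val_rev]; omega), hv, h.hyp _ (by omega),
      rhoPow_eq_topPow hq hi, smul_smul]
    congr 1
    field_simp
  · have ht := topPow_ne_zero N hq
    have h1 := one_add_ofReal_ne_zero hq
    have hpow : (q : ℂ) ^ (i : ℕ) ≠ 0 := pow_ne_zero _ hq0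
    have hlt : (i : ℕ) < N / 2 + 1 := by omega
    rw [metricSum_pairRealization hq a b (by omega), pairRealization_of_eq q a b hi]
    -- Only the anticommutator survives. Matching it with `(q - 1)` times the metric sum fixes
    -- `midCoeff`, as `(q ^ 2 - 1) * (1 + q)⁻¹ = q - 1`.
    calc (a i + midCoeff N q • b i) * (a i + midCoeff N q • b i)
        = a i * a i + midCoeff N q • (b i * a i + a i * b i)
            + midCoeff N q • midCoeff N q • (b i * b i) := by
          simp only [add_mul, mul_add, smul_mul_assoc, mul_smul_comm, smul_add]
          abel
      _ = _ := by
        rw [h.a_sq _ hlt, h.b_sq _ hlt, h.hyp _ hlt, smul_zero, smul_zero, zero_add, add_zero,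
          smul_smul, smul_smul, midCoeff, show N / 2 = (i : ℕ) by omega]
        congr 1
        field_simp
        ring

/-- The volume form does not vanish in the realization. -/
lemma IsPairSystem.prod_ne_zero {N : ℕ} {q : ℝ} (hq : 0 < q) {a b : ℕ → B}
    (h : IsPairSystem (q : ℂ) (N / 2 + 1) a b)
    (hne : initProd a (N / 2 + 1) * revProd b (N / 2 + 1) ≠ 0) :
    (List.ofFn fun i : Fin N => pairRealization N q a b i).prod ≠ 0 := by
  have hqi : (-(q : ℂ)⁻¹) ≠ 0 := neg_ne_zero.2 (inv_ne_zero (Complex.ofReal_ne_zero.2 hq.ne'))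
  rw [prod_ofFn_eq_initProd _ (pairRealization N q a b) fun _ => rfl]
  obtain ⟨n, hn⟩ : ∃ n, n = N / 2 := ⟨_, rfl⟩
  rw [← hn] at h hne
  have ha : initProd (pairRealization N q a b) n = initProd a n :=
    initProd_congr fun i hi => pairRealization_of_lt q a b (by omega)
  have haR : a n * revProd b n = (-(q : ℂ)⁻¹) ^ n • (revProd b n * a n) :=
    mul_revProd fun j hj => h.ab j n hj (by omega)
  have hbR : b n * revProd b n = (-(q : ℂ)⁻¹) ^ n • (revProd b n * b n) :=
    mul_revProd fun j hj => h.bb j n hj (by omega)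
  have hd : (-(q : ℂ)⁻¹) ^ n ≠ 0 := pow_ne_zero _ hqi
  rw [initProd, revProd] at hne
  intro h0
  apply hne
  -- In both parities the nonzero product with `n + 1` pairs is, up to scalars, a right multiple of
  -- the volume form: by `a n * b n` for even `N`, and by `b n` for odd `N`, where the `b n` part of
  -- the middle generator drops out.
  rcases Nat.mod_two_eq_zero_or_one N with hN | hN
  · have e : initProd (pairRealization N q a b) N = initProd a n * revProd b n := by
      rw [← ha, ← initProd_add n n, show n + n = N by omega]
      intro i hi
      rw [pairRealization_of_gt q a b (by omega)]
      congr 1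
      omega
    rw [e] at h0
    calc initProd a n * a n * (b n * revProd b n)
        = (-(q : ℂ)⁻¹) ^ n • (initProd a n * (a n * revProd b n) * b n) := by
          rw [hbR, mul_smul_comm]; simp only [mul_assoc]
      _ = (-(q : ℂ)⁻¹) ^ n • (-(q : ℂ)⁻¹) ^ n • (initProd a n * revProd b n * a n * b n) := by
          rw [haR, mul_smul_comm, smul_mul_assoc]; simp only [mul_assoc]
      _ = 0 := by rw [h0, zero_mul, zero_mul, smul_zero, smul_zero]
  · have e : initProd (pairRealization N q a b) N =
        initProd a n * (a n + midCoeff N q • b n) * revProd b n := by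
      rw [← ha, ← pairRealization_of_eq q a b (by omega : 2 * n + 1 = N)]
      have := initProd_add (x := pairRealization N q a b) (b := b) (n + 1) n ?_
      · rw [← initProd, ← this, show n + 1 + n = N by omega]
      intro i hi
      rw [pairRealization_of_gt q a b (by omega)]
      congr 1
      omega
    rw [e] at h0
    have hbb : b n * revProd b n * b n = 0 := by
      rw [hbR, smul_mul_assoc, mul_assoc, h.b_sq n (by omega), mul_zero, smul_zero]
    calc initProd a n * a n * (b n * revProd b n)
        = (-(q : ℂ)⁻¹) ^ n • (initProd a n * a n * revProd b n * b n) := by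
          rw [hbR, mul_smul_comm]; simp only [mul_assoc]
      _ = (-(q : ℂ)⁻¹) ^ n • (initProd a n * (a n + midCoeff N q • b n) * revProd b n * b n
            - midCoeff N q • (initProd a n * (b n * revProd b n * b n))) := by
          congr 1
          simp only [mul_add, add_mul, mul_smul_comm, smul_mul_assoc, mul_assoc]
          rw [add_sub_cancel_right]
      _ = 0 := by rw [h0, hbb]; simp

end Realization

/-! ### The algebra of forms: top degree and cyclicity. -/

section Forms

variable {N : ℕ} {q : ℝ}

lemma dx_relations (q : ℝ) (i j : Fin N) : dx q i * dx q j =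
    ∑ k, ∑ l, ((-(q * Rhat q i j k l) : ℝ) : ℂ) • (dx q k * dx q l) := by
  have h := RingQuot.mkAlgHom_rel ℂ (FormRel.comm (N := N) (q := q) i j)
  simp only [map_mul, map_sum, map_smul] at h
  exact h

/-- Families satisfying the commutation relations define homomorphisms out of the forms. -/
lemma exists_lift {B : Type*} [Ring B] [Algebra ℂ B] {X : Fin N → B}
    (h : ∀ i j, X i * X j = ∑ k, ∑ l, ((-(q * Rhat q i j k l) : ℝ) : ℂ) • (X k * X l)) :
    ∃ f : Forms N q →ₐ[ℂ] B, ∀ i, f (dx q i) = X i := by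
  refine ⟨RingQuot.liftAlgHom ℂ ⟨FreeAlgebra.lift ℂ X, ?_⟩, fun i => ?_⟩
  · rintro _ _ ⟨i, j⟩
    simpa only [map_mul, map_sum, map_smul, FreeAlgebra.lift_ι_apply] using h i j
  · rw [dx, RingQuot.liftAlgHom_mkAlgHom_apply, FreeAlgebra.lift_ι_apply]

lemma dxWord_id_ne_zero (N : ℕ) (hq : 0 < q) : dxWord q (id : Fin N → Fin N) ≠ 0 := by
  obtain ⟨B, _, _, a, b, s, t, h, hne⟩ :=
    exists_isTwistedPairSystem (Complex.ofReal_ne_zero.2 hq.ne') (N / 2 + 1)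
  obtain ⟨f, hf⟩ := exists_lift ((h.toIsPairSystem.isExterior hq).relations hq)
  intro h0
  apply h.toIsPairSystem.prod_ne_zero hq hne
  have := congrArg f h0
  rw [dxWord, map_list_prod, List.map_ofFn, map_zero] at this
  rw [← this]
  congr 2
  ext i
  exact (hf i).symm

lemma isTower_dx (N : ℕ) (hq : 0 < q) : IsTower (q : ℂ) N (pairSeq (dx (N := N) q)) :=
  (isExterior_of_relations hq (dx_relations q)).isTower hq

/-- Top degree is spanned by the product in pair order. The volume form in natural order is a
multiple of it, nonzero by `dxWord_id_ne_zero`, and so spans as well. -/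
lemma dxWord_mem_span (hq : 0 < q) (i : Fin N → Fin N) :
    dxWord q i ∈ Submodule.span ℂ {dxWord q (id : Fin N → Fin N)} := by
  have hle := ((isTower_dx N hq).initSpan_pow le_rfl).2
  have hmem : ∀ i : Fin N → Fin N, dxWord q i ∈ initSpan (pairSeq (dx (N := N) q)) N ^ N :=
    fun i => prod_ofFn_mem_pow _ fun k => mem_initSpan_pairSeq (dx q) (i k)
  obtain ⟨c, hc⟩ := Submodule.mem_span_singleton.1 (hle (hmem id))
  obtain ⟨d, hd⟩ := Submodule.mem_span_singleton.1 (hle (hmem i))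
  have hc0 : c ≠ 0 := by
    rintro rfl
    exact dxWord_id_ne_zero N hq (by rw [← hc, zero_smul])
  refine Submodule.mem_span_singleton.2 ⟨d * c⁻¹, ?_⟩
  rw [← hc, smul_smul, inv_mul_cancel_right₀ hc0, hd]

/-- Moving the first differential of a form of top degree to the end. -/
lemma dxWord_eq_smul_cycleIndex (hq : 0 < q) (hN : 0 < N) (i : Fin N → Fin N) :
    dxWord q i = ((-1) ^ (N - 1) * (rhoPow q (i ⟨0, hN⟩) ^ 2)⁻¹) •
      dxWord q (cycleIndex i (i ⟨0, hN⟩)) := by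
  obtain ⟨M, rfl⟩ : ∃ M, N = M + 1 := ⟨N - 1, by omega⟩
  set w := (List.ofFn fun k : Fin M => dx q (i k.succ)).prod with hw
  have h1 : dxWord q i = dx q (i 0) * w := by
    rw [dxWord, List.ofFn_succ, List.prod_cons]
  have h2 : dxWord q (cycleIndex i (i 0)) = w * dx q (i 0) := by
    rw [dxWord, List.ofFn_succ', List.concat_eq_append, List.prod_append, List.prod_singleton]
    congr 1
    · rw [hw]
      congr 2
      ext k
      rw [cycleIndex, dif_pos (by simp)]
      rfl
    · rw [cycleIndex, dif_neg (by simp)]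
  have hmem : w ∈ initSpan (pairSeq (dx (N := M + 1) q)) (M + 1) ^ M :=
    prod_ofFn_mem_pow _ fun k => mem_initSpan_pairSeq (dx q) (i k.succ)
  obtain ⟨k, hk⟩ := pairIndex_surjective (i 0)
  have key := (isTower_dx (M + 1) hq).mul_eq_cyclicFactor_smul
    (Complex.ofReal_ne_zero.2 hq.ne') M.lt_succ_self (Nat.lt_succ_iff.1 k.isLt) hmem
  rw [pairSeq_of_lt _ k.isLt, cyclicFactor_eq hq k] at key
  change dxWord q i = ((-1) ^ (M + 1 - 1) * (rhoPow q (i 0) ^ 2)⁻¹) •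
    dxWord q (cycleIndex i (i 0))
  rw [h1, h2, ← hk]
  exact key

end Forms

end QEuclid
end

theorem proposition2 (N : ℕ) (hN : 3 ≤ N) (q : ℝ) (hq : 0 < q) :
    (∃! ε : (Fin N → Fin N) → ℂ, QEuclid.IsEpsilonTensor N q ε) ∧
    ∀ ε : (Fin N → Fin N) → ℂ, QEuclid.IsEpsilonTensor N q ε →
      ∀ i : Fin N → Fin N,
        ε i = (-1) ^ (N - 1) *
          ∑ j : Fin N, (QEuclid.D N q (i ⟨0, by omega⟩) j : ℂ) * ε (QEuclid.cycleIndex i j) := by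
  have hne := QEuclid.dxWord_id_ne_zero N hq
  constructor
  · choose ε hε using fun i =>
      Submodule.mem_span_singleton.1 (QEuclid.dxWord_mem_span (N := N) hq i)
    refine ⟨ε, fun i => (hε i).symm, fun ε' hε' => funext fun i => ?_⟩
    exact smul_left_injective ℂ hne ((hε' i).symm.trans (hε i).symm)
  · intro ε hε i
    have h := QEuclid.dxWord_eq_smul_cycleIndex hq (by omega) i
    rw [hε i, hε (QEuclid.cycleIndex i _), smul_smul] at h
    have h' := smul_left_injective ℂ hne h
    simp only [QEuclid.D_apply hq, ite_mul, zero_mul, Finset.sum_ite_eq, Finset.mem_univ, if_true]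
    rw [h', mul_assoc]
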